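/- **Setting.** Let $N\in\mathbb N$, $T>0$, $\mathcal I=\{0,1\}^N$, $\bar p=(1,\dots,1)$. For $p\in\mathcal I$ let $\mathcal I_p$ be the set of the strings obtained from $p$ by changing exactly one component, from $0$ to $1$. Let $\mathcal M=L^2([0,T],[0,1])^{\mathcal I}$, with the $L^2$ norm. The data are initial masses $\rho^0_p\ge 0$ $(p\in\mathcal I)$ with $\sum_p\rho^0_p\le 1$, a final cost $\tilde C(p,t)\in\mathbb R$ which is Lipschitz continuous (hence bounded) in $t\in[0,T]$, and a switching cost $C(p,p',t,\tau,\rho)\ge 0$, defined for $p'\in\mathcal I_p$, $0\le t<\tau\le T$, $\rho\in\mathcal M$, such that: * for all sufficiently small $h>0$ there are constants $L,B$ depending only on $h$ such that for all $p$, $p'\in\mathcal I_p$ and $\tau\in\,]0,T]$ the map $(t,\rho)\mapsto C(p,p',t,\tau,\rho)$ is bounded by $B$ and $|C(p,p',t_1,\tau,\rho_1)-C(p,p',t_2,\tau,\rho_2)|\le L(|t_1-t_2|+\|\rho_1-\rho_2\|_{L^2})$ on $[0,\tau-h]\times\mathcal M$; * $\tau\mapsto C(p,p',t,\tau,\rho)$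 is nonincreasing on $]t,T]$ and continuous on $]t,T[$, and $C(p,p',t,\tau,\rho)\to+\infty$ as $\tau\to t^+$, uniformly in $(p,p',t,\rho)$. A *control* from $(p,t)$ consists of $r\ge0$, nodes $p=p_0,p_1,\dots,p_r$ with $p_{i+1}\in\mathcal I_{p_i}$, and instants $t=t_0<t_1<\dots<t_r\le T$, where $p_r=\bar p$ or $t_r=T$. Its cost is $J=\sum_{i=1}^r C(p_{i-1},p_i,t_{i-1},t_i,\rho)+\tilde C(p_r,t_r)$, and $V(p,t,\rho)$ is the infimum of $J$ over the controls from $(p,t)$. For $p'\in\mathcal I_p$ and $t<T$ let $\varphi^\rho_{p,p'}(t)$ be the set of the $\tau\in\,]t,T]$ such that some control from $(p,t)$ with first switch to $p'$ at the instant $\tau$ minimizes $J$ among all controls from $(p,t)$ whose first switch goes to $p'$. Assume moreover that * if $t_1<t_2$, $\tau_1\in\varphi^\rho_{p,p'}(t_1)$, $\tau_2\in\varphi^\rho_{p,p'}(t_2)$ and $\tau_1,\tau_2<T$, then $\tau_1<\tau_2$. For $p\ne\bar p$, $t<T$ let $P_\rho(p,t)$ be the set of the minimum points $(p',\tau)$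 of $V(p',\tau,\rho)+C(p,p',t,\tau,\rho)$ over $p'\in\mathcal I_p$, $\tau\in\,]t,T]$. An *optimal path* from $(j,0)$ is a finite sequence $(j,0)=(p_0,t_0),(p_1,t_1),\dots,(p_r,t_r)$ with $(p_{i+1},t_{i+1})\in P_\rho(p_i,t_i)$ for $i<r$, and $p_r=\bar p$ or $t_r=T$. A pair $(p,t)$ with $p\neq\bar p$, $t<T$ is a *decision pair* for $\rho$ if it lies on an optimal path from some $(j,0)$ with $\rho^0_j>0$. **The map $\psi$.** For $\rho\in\mathcal M$, $\psi(\rho)$ is the set of the $\tilde\rho\in\mathcal M$ for which there are convex coefficients $\lambda_{p,p'}(t,\tau)\ge0$ (for each $p\ne\bar p$, $t\in[0,T[$: finitely many nonzero, with sum $1$ over $(p',\tau)$, and zero unless $(p',\tau)\in P_\rho(p,t)$) such that, for every $k\in\mathcal I$ and almost every $s\in[0,T]$, $$\tilde\rho_k(s)=\sum_{j\in\mathcal I}\rho^0_j\sum_{\pi}\ \prod_{i=0}^{r-1}\lambda_{p_i,p_{i+1}}(t_i,t_{i+1}),$$ where $\pi=((p_i,t_i))_{0\le i\le r}$ runs over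 the optimal paths from $(j,0)$ which are on $k$ at time $s$, that is, $p_i=k$ for some $i$ with $t_i\le s$ and, if $i<r$, $s<t_{i+1}$. **Theorem 6.1.** Assume that $\varphi$ is single-valued at the decision instants: for every $\rho\in\mathcal M$, every decision pair $(p,t)$ for $\rho$ and every $p'\in\mathcal I_p$, the set $\varphi^\rho_{p,p'}(t)$ has at most one element. Then there is a mean-field equilibrium, i.e. there is $\rho\in\mathcal M$ with $\rho\in\psi(\rho)$. -/

import Mathlib

open Set Filter Topology MeasureTheory

/-- The nodes of the network: strings of length `N` in the two symbols `0` (`false`) and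
`1` (`true`). -/
abbrev Node (N : ℕ) : Type := Fin N → Bool

/-- The final destination `(1, …, 1)`. -/
def finalNode (N : ℕ) : Node N := fun _ => true

/-- The nodes that can be reached from `p` by one switch: exactly one component flips, and it flips
from `0` to `1`. -/
def nextNodes {N : ℕ} (p : Node N) : Set (Node N) :=
  {q | ∃ i, p i = false ∧ q = Function.update p i true}

/-- Lebesgue measure on `[0, T]`. -/
noncomputable def timeMeasure (T : ℝ) : Measure ℝ := volume.restrict (Icc 0 T)

/-- `L²([0, T], [0, 1])` to the power of the number of nodes, as a subset of the product of the
spaces `L²([0, T])`, whose (maximum) norm is equivalent to the Euclidean product norm. -/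
def MassSpace (N : ℕ) (T : ℝ) : Set (Node N → Lp ℝ 2 (timeMeasure T)) :=
  {ρ | ∀ p, ∀ᵐ t ∂(timeMeasure T), ρ p t ∈ Icc (0 : ℝ) 1}

/-- The data of the switching game on the network with `N` targets. -/
structure SwitchingGame (N : ℕ) where
  /-- The final time. -/
  T : ℝ
  /-- The switching cost `C(p, q, t, τ, ρ)`: being on `p`, one decides at time `t` to switch to `q`
  at time `τ`. Only the values with `q ∈ nextNodes p` and `0 ≤ t < τ ≤ T` are ever used. -/
  C : Node N → Node N → ℝ → ℝ → MassSpace N T → ℝ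
  /-- The final cost, for a path which ends on a given node at a given time. -/
  Cfin : Node N → ℝ → ℝ
  /-- The mass of the agents which are on a given node at time `0`. -/
  init : Node N → ℝ

namespace SwitchingGame

variable {N : ℕ}

/-- Admissible controls for an agent on `p` at time `t`. The control with nodes `p = p₀, p₁, …, p_r`
and instants `t = t₀ < t₁ < … < t_r ≤ T` is coded by the list `[(p₁, t₁), …, (p_r, t_r)]`; the path
may end only on the final node or at the final time. -/
def IsControl (G : SwitchingGame N) : Node N → ℝ → List (Node N × ℝ) → Prop
  | p, t, [] => (p = finalNode N ∧ t ≤ G.T) ∨ t = G.T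
  | p, t, (q, τ) :: l => q ∈ nextNodes p ∧ t < τ ∧ τ ≤ G.T ∧ G.IsControl q τ l

/-- The cost `J(p, t, control, ρ)`: the sum of the switching costs along the path, plus the final
cost of its last pair (node, instant). -/
def J (G : SwitchingGame N) (ρ : MassSpace N G.T) : Node N → ℝ → List (Node N × ℝ) → ℝ
  | p, t, [] => G.Cfin p t
  | p, t, (q, τ) :: l => G.C p q t τ ρ + G.J ρ q τ l

/-- The value function `V(p, t, ρ)`: the infimum of `J` over the admissible controls. -/
noncomputable def V (G : SwitchingGame N) (ρ : MassSpace N G.T) (p : Node N) (t : ℝ) : ℝ :=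
  sInf (G.J ρ p t '' {l | G.IsControl p t l})

/-- The switch from `p` to `q` with decision instant `t` optimally generates the switching instant
`τ`: some control whose first switch is `(q, τ)` minimizes `J` among all the controls whose first
switch goes to `q` (at any instant). In other words `τ` is a value at `t` of the
(possibly multivalued) map `φ` attached to `p`, `q` and `ρ`. -/
def OptGenerates (G : SwitchingGame N) (ρ : MassSpace N G.T) (p q : Node N) (t τ : ℝ) : Prop :=
  ∃ l, G.IsControl p t ((q, τ) :: l) ∧
    ∀ τ₁ l₁, G.IsControl p t ((q, τ₁) :: l₁) → G.J ρ p t ((q, τ) :: l) ≤ G.J ρ p t ((q, τ₁) :: l₁)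

/-- The standing assumptions on the data. -/
structure Standing (G : SwitchingGame N) : Prop where
  T_pos : 0 < G.T
  init_nonneg : ∀ p, 0 ≤ G.init p
  init_sum_le : ∑ p, G.init p ≤ 1
  /-- The switching cost is nonnegative. -/
  C_nonneg : ∀ p, ∀ q ∈ nextNodes p, ∀ t τ, 0 ≤ t → t < τ → τ ≤ G.T → ∀ ρ, 0 ≤ G.C p q t τ ρ
  /-- For all small `h > 0`, the map `(t, ρ) ↦ C(p, q, t, τ, ρ)` is bounded and Lipschitz continuous
  for `t ∈ [0, τ - h]`, with constants which depend only on `h`. -/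
  C_lipschitz : ∀ᶠ h in 𝓝[>] (0 : ℝ), ∃ L B : ℝ, ∀ p, ∀ q ∈ nextNodes p, ∀ τ ∈ Ioc 0 G.T,
    (∀ t ∈ Icc 0 (τ - h), ∀ ρ, |G.C p q t τ ρ| ≤ B) ∧
    ∀ t₁ ∈ Icc 0 (τ - h), ∀ t₂ ∈ Icc 0 (τ - h), ∀ ρ₁ ρ₂ : MassSpace N G.T,
      |G.C p q t₁ τ ρ₁ - G.C p q t₂ τ ρ₂| ≤ L * (|t₁ - t₂| + ‖ρ₁.1 - ρ₂.1‖)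
  /-- The switching cost is decreasing (in the weak sense) in the switching instant. -/
  C_antitone : ∀ p, ∀ q ∈ nextNodes p, ∀ t ∈ Ico 0 G.T, ∀ ρ,
    AntitoneOn (fun τ => G.C p q t τ ρ) (Ioc t G.T)
  /-- The switching cost tends to `+∞` as `τ ↓ t`, uniformly in all the other variables. -/
  C_blowup : ∀ M : ℝ, ∃ δ > 0, ∀ p, ∀ q ∈ nextNodes p, ∀ t ∈ Ico 0 G.T, ∀ τ ∈ Ioc t G.T,
    τ - t < δ → ∀ ρ, M ≤ G.C p q t τ ρ
  /-- The switching cost is continuous in the switching instant before the final time. -/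
  C_continuous : ∀ p, ∀ q ∈ nextNodes p, ∀ t ∈ Ico 0 G.T, ∀ ρ,
    ContinuousOn (fun τ => G.C p q t τ ρ) (Ioo t G.T)
  /-- The final cost is Lipschitz continuous in time on `[0, T]` (hence bounded there). -/
  Cfin_lipschitz : ∃ K, ∀ p, LipschitzOnWith K (G.Cfin p) (Icc 0 G.T)
  /-- Later decisions optimally generate strictly later switches, before the final time. -/
  phi_strictMono : ∀ ρ p, ∀ q ∈ nextNodes p, ∀ t₁ ∈ Ico 0 G.T, ∀ t₂ ∈ Ico 0 G.T, ∀ τ₁ τ₂,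
    t₁ < t₂ → τ₁ < G.T → τ₂ < G.T →
    G.OptGenerates ρ p q t₁ τ₁ → G.OptGenerates ρ p q t₂ τ₂ → τ₁ < τ₂

/-- The set `P(p, t)` of the optimal pairs (next node, switching instant): the minimum points of
`(q, τ) ↦ V(q, τ) + C(p, q, t, τ)` over `q ∈ nextNodes p` and `τ ∈ ]t, T]`. It is empty if `p` is
the final node or if `t ≥ T`. -/
def P (G : SwitchingGame N) (ρ : MassSpace N G.T) (p : Node N) (t : ℝ) : Set (Node N × ℝ) :=
  {x | x ∈ nextNodes p ×ˢ Ioc t G.T ∧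
    IsMinOn (fun y : Node N × ℝ => G.V ρ y.1 y.2 + G.C p y.1 t y.2 ρ) (nextNodes p ×ˢ Ioc t G.T) x}

/-- The pairs (node, instant) which the agents may reach, starting from their node at time `0` and
always performing optimal switches with respect to the mass `ρ`. -/
inductive Reached (G : SwitchingGame N) (ρ : MassSpace N G.T) : Node N → ℝ → Prop
  | start (p : Node N) : 0 < G.init p → G.Reached ρ p 0
  | step (p q : Node N) (t τ : ℝ) : G.Reached ρ p t → (q, τ) ∈ G.P ρ p t → G.Reached ρ q τ

/-- The maps `φ` are single-valued at the decision instants of the agents: for every mass `ρ`,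
an agent which decides at the instant `t`, on the node `p`, to switch to `q`, has at most one
optimally generated switching instant. -/
def PhiSingleValued (G : SwitchingGame N) : Prop :=
  ∀ ρ p t, G.Reached ρ p t → ∀ q ∈ nextNodes p, ∀ τ₁ τ₂,
    G.OptGenerates ρ p q t τ₁ → G.OptGenerates ρ p q t τ₂ → τ₁ = τ₂

/-- The optimal switching paths from `(p, t)`, coded as lists of pairs (node, switching instant):
every switch is in `P`, until the final node or the final time is reached. -/
def IsOptPath (G : SwitchingGame N) (ρ : MassSpace N G.T) :
    Node N → ℝ → List (Node N × ℝ) → Prop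
  | p, t, [] => p = finalNode N ∨ t = G.T
  | p, t, (q, τ) :: l => (q, τ) ∈ G.P ρ p t ∧ G.IsOptPath ρ q τ l

/-- A choice of convex coefficients at every decision node: `lam p t (q, τ)` is the fraction of the
agents deciding on `p` at time `t` which choose to switch to `q` at time `τ`. Only finitely many
choices, all of them optimal, are used at each decision node. -/
def IsSplitting (G : SwitchingGame N) (ρ : MassSpace N G.T)
    (lam : Node N → ℝ → (Node N × ℝ) →₀ ℝ) : Prop :=
  ∀ p, p ≠ finalNode N → ∀ t ∈ Ico 0 G.T,
    (∀ x, 0 ≤ lam p t x) ∧ (∀ x, lam p t x ≠ 0 → x ∈ G.P ρ p t) ∧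
    ((lam p t).sum fun _ a => a) = 1

/-- The product of the coefficients along a path which starts from `(p, t)`. -/
def weight (lam : Node N → ℝ → (Node N × ℝ) →₀ ℝ) : Node N → ℝ → List (Node N × ℝ) → ℝ
  | _, _, [] => 1
  | p, t, (q, τ) :: l => lam p t (q, τ) * weight lam q τ l

/-- The indicator that an agent following a path which starts from `(p, t)` is on the node `k` at
time `s`: it stays on each node from its arrival until just before the next switching instant, and
on the last node forever. -/
noncomputable def presence : Node N → ℝ → List (Node N × ℝ) → Node N → ℝ → ℝ
  | p, t, [], k, s => if p = k ∧ t ≤ s then 1 else 0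
  | p, t, (q, τ) :: l, k, s =>
      (if p = k ∧ t ≤ s ∧ s < τ then 1 else 0) + presence q τ l k s

/-- The evolution of the mass of the agents: the mass on node `k` at time `s` is the sum, over the
initial nodes `j` and the optimal paths from `(j, 0)` which are on `k` at time `s`, of the initial
mass on `j` times the product of the coefficients along the path (only finitely many terms of the
sum over the paths are nonzero). -/
noncomputable def evolution (G : SwitchingGame N) (ρ : MassSpace N G.T)
    (lam : Node N → ℝ → (Node N × ℝ) →₀ ℝ) (k : Node N) (s : ℝ) : ℝ :=
  ∑ j, G.init j * ∑ᶠ l ∈ {l | G.IsOptPath ρ j 0 l}, weight lam j 0 l * presence j 0 l k s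

/-- The multivalued map `ψ`: the mass evolutions generated by `ρ`, with agents which split
at each decision node among the choices that are optimal with respect to `ρ`. -/
def psi (G : SwitchingGame N) (ρ : MassSpace N G.T) : Set (MassSpace N G.T) :=
  {ρ' | ∃ lam, G.IsSplitting ρ lam ∧
    ∀ k, ∀ᵐ s ∂(timeMeasure G.T), ρ'.1 k s = G.evolution ρ lam k s}

end SwitchingGame

/-! Call an evolution pure if all agents with the same initial node follow the same optimal path;
`purePsi` collects these evolutions for a given mass. A path has at most `N` switches, with instants
in `[0, T]`, so families of paths have limits along ultrafilters. The blow-up of the switching cost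
keeps the gaps between the instants of controls of bounded cost away from zero, so limits of such
controls are controls, and the cost is lower semicontinuous (`eventually_J_le`). For a fixed control
the cost is continuous in the mass. Hence limits of optimal controls are optimal
(`isOptControl_of_tendsto`). Since the indicator of a half-line moves continuously in `L²` with its
endpoint, `purePsi` is upper hemicontinuous with totally bounded range.

The Kakutani–Fan–Glicksberg theorem, obtained from Brouwer's by a partition of unity, then gives a
mass `ρ` in the closed convex hull of `purePsi ρ`. Single-valuedness of `φ` makes an optimal path
from a reached pair depend only on its nodes. So there are finitely many pure evolutions, their
convex hull is already closed, and `ρ` is a true convex combination.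

It remains to realize such a combination by splitting coefficients, which know the current decision
pair but not the past (`mem_psi_of_mem_convexHull`). The coefficient of a switch is the mass flowing
through it divided by the mass deciding at its starting pair. The evolution is unchanged: the
expected presence from a pair, under these coefficients, is preserved on average by each decision.
The corresponding gains telescope along every path, while their sum over the whole flow vanishes. -/

/-! ### Brouwer's theorem on the ball, by a volume argument. -/

open Polynomial in
/-- The determinant `det (1 + t A)`, being a polynomial in `t` of degree at most the dimension, is
determined by its values at sufficiently many points. -/
theorem det_one_add_eq_sum_lagrange {ι : Type*} [Fintype ι]
    (A : EuclideanSpace ℝ ι →L[ℝ] EuclideanSpace ℝ ι) (v : Fin (Fintype.card ι + 1) → ℝ)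
    (hv : Function.Injective v) :
    (1 + A).det = ∑ i, (Lagrange.basis Finset.univ v i).eval 1 * (1 + v i • A).det := by
  classical
  let b := (EuclideanSpace.basisFun ι ℝ).toBasis
  let M := LinearMap.toMatrix b b A.toLinearMap
  let p : ℝ[X] := ((X : ℝ[X]) • M.map (C : ℝ → ℝ[X]) + (1 : Matrix ι ι ℝ).map (C : ℝ → ℝ[X])).det
  have hp : ∀ t : ℝ, p.eval t = (1 + t • A).det := by
    intro t
    have h1 : (1 + t • A).det = LinearMap.det ((1 : EuclideanSpace ℝ ι →ₗ[ℝ] EuclideanSpace ℝ ι)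
        + t • A.toLinearMap) := rfl
    rw [h1, ← LinearMap.det_toMatrix b, map_add, map_smul, LinearMap.toMatrix_one]
    simp only [p]
    rw [← coe_evalRingHom, RingHom.map_det]
    congr 1
    ext i j
    by_cases hij : i = j <;> simp [M, hij] <;> ring
  have hdeg : p.degree < (Finset.univ : Finset (Fin (Fintype.card ι + 1))).card := by
    have h := Polynomial.natDegree_det_X_add_C_le M (1 : Matrix ι ι ℝ)
    refine lt_of_le_of_lt degree_le_natDegree ?_
    simp only [Finset.card_univ, Fintype.card_fin]
    exact_mod_cast Nat.lt_succ_of_le h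
  have h := Lagrange.eq_interpolate (v := v) hv.injOn hdeg
  have h2 := congrArg (eval (1 : ℝ)) h
  rw [Lagrange.interpolate_apply, eval_finsetSum, hp, one_smul] at h2
  rw [h2]
  refine Finset.sum_congr rfl fun i _ => ?_
  rw [eval_mul, eval_C, hp, mul_comm]

theorem sum_lagrange_basis_eval_one {n : ℕ} (v : Fin (n + 1) → ℝ) (hv : Function.Injective v) :
    ∑ i, (Lagrange.basis Finset.univ v i).eval 1 = 1 := by
  rw [← Polynomial.eval_finsetSum, Lagrange.sum_basis hv.injOn Finset.univ_nonempty]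
  simp

/-- A kernel vector `w` of `1 + s A` with `s ∈ [0, 1]` would satisfy `‖w‖ ≤ ‖A‖ ‖w‖`, so the
determinant does not vanish for such `s`. It equals `1` at `s = 0` and cannot change sign. -/
theorem det_one_add_pos {E : Type*} [NormedAddCommGroup E] [NormedSpace ℝ E]
    [FiniteDimensional ℝ E] (A : E →L[ℝ] E) (hA : ‖A‖ < 1) : 0 < (1 + A).det := by
  have hne : ∀ s ∈ Icc (0 : ℝ) 1, (1 + s • A).det ≠ 0 := by
    intro s hs h0
    have : ∃ w, w ≠ 0 ∧ (1 + s • A) w = 0 := by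
      have h1 : LinearMap.det ((1 + s • A : E →L[ℝ] E) : E →ₗ[ℝ] E) = 0 := h0
      obtain ⟨w, hw, hw0⟩ := (Submodule.ne_bot_iff _).1
        (LinearMap.bot_lt_ker_of_det_eq_zero h1).ne'
      exact ⟨w, hw0, hw⟩
    obtain ⟨w, hw0, hw⟩ := this
    have hw' : w = -(s • A w) := by
      have : w + s • A w = 0 := hw
      exact eq_neg_of_add_eq_zero_left this
    have h2 : ‖w‖ ≤ ‖A‖ * ‖w‖ := by
      calc ‖w‖ = ‖s • A w‖ := by conv_lhs => rw [hw', norm_neg]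
        _ = s * ‖A w‖ := by rw [norm_smul, Real.norm_of_nonneg hs.1]
        _ ≤ 1 * ‖A w‖ := by gcongr; exact hs.2
        _ ≤ ‖A‖ * ‖w‖ := by rw [one_mul]; exact A.le_opNorm w
    have : 0 < ‖w‖ := norm_pos_iff.2 hw0
    nlinarith
  by_contra hcon
  have hc : ContinuousOn (fun s : ℝ => (1 + s • A).det) (Icc 0 1) :=
    (ContinuousLinearMap.continuous_det.comp (by fun_prop)).continuousOn
  have h0 : (0 : ℝ) ∈ Icc ((1 + (1 : ℝ) • A).det) ((1 + (0 : ℝ) • A).det) := by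
    constructor
    · simpa using hcon
    · simp [ContinuousLinearMap.det]
  obtain ⟨s, hs, hs0⟩ := intermediate_value_Icc' zero_le_one hc h0
  exact hne s hs hs0

/-- The radial retraction onto the closed unit ball. -/
noncomputable def radialRetraction {E : Type*} [NormedAddCommGroup E] [NormedSpace ℝ E] (x : E) :
    E := (max 1 ‖x‖)⁻¹ • x

section Radial

variable {E : Type*} [NormedAddCommGroup E] [NormedSpace ℝ E]

theorem radialRetraction_of_norm_le {x : E} (hx : ‖x‖ ≤ 1) : radialRetraction x = x := by
  simp [radialRetraction, max_eq_left hx]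

theorem norm_radialRetraction_of_one_le {x : E} (hx : 1 ≤ ‖x‖) : ‖radialRetraction x‖ = 1 := by
  have : ‖x‖ ≠ 0 := by positivity
  simp [radialRetraction, max_eq_right hx, norm_smul, this]

theorem norm_radialRetraction_le (x : E) : ‖radialRetraction x‖ ≤ 1 := by
  rcases le_total ‖x‖ 1 with h | h
  · rwa [radialRetraction_of_norm_le h]
  · exact (norm_radialRetraction_of_one_le h).le

/-- Rescaling `x - y` costs at most `‖x - y‖`, and so does changing the scaling factor on `y`. The
constant `2` comes from adding the two and is valid for any norm. -/
theorem norm_radialRetraction_sub_le (x y : E) :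
    ‖radialRetraction x - radialRetraction y‖ ≤ 2 * ‖x - y‖ := by
  unfold radialRetraction
  set a := max 1 ‖x‖
  set b := max 1 ‖y‖
  have ha : 1 ≤ a := le_max_left _ _
  have hb : 1 ≤ b := le_max_left _ _
  have hyb : ‖y‖ ≤ b := le_max_right _ _
  have hab : |b - a| ≤ ‖x - y‖ := by
    rw [abs_sub_comm]
    refine (abs_max_sub_max_le_max 1 ‖x‖ 1 ‖y‖).trans ?_
    simpa using abs_norm_sub_norm_le x y
  have h1 : a⁻¹ • x - b⁻¹ • y = a⁻¹ • (x - y) + (a⁻¹ - b⁻¹) • y := by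
    rw [smul_sub, sub_smul]; abel
  have h2 : a⁻¹ - b⁻¹ = (b - a) * (a⁻¹ * b⁻¹) := by field_simp
  have h3 : ‖(a⁻¹ - b⁻¹) • y‖ ≤ ‖x - y‖ := by
    rw [norm_smul, h2, norm_mul, Real.norm_eq_abs, Real.norm_of_nonneg (by positivity)]
    have : a⁻¹ * b⁻¹ * ‖y‖ ≤ 1 := by
      have e : b⁻¹ * ‖y‖ ≤ 1 := by
        rw [inv_mul_le_iff₀ (by positivity)]; simpa using hyb
      have e2 : a⁻¹ ≤ 1 := inv_le_one_of_one_le₀ ha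
      calc a⁻¹ * b⁻¹ * ‖y‖ = a⁻¹ * (b⁻¹ * ‖y‖) := by ring
        _ ≤ 1 * 1 := by gcongr
        _ = 1 := by ring
    calc |b - a| * (a⁻¹ * b⁻¹) * ‖y‖ = |b - a| * (a⁻¹ * b⁻¹ * ‖y‖) := by ring
      _ ≤ ‖x - y‖ * 1 := by gcongr
      _ = _ := mul_one _
  have h4 : ‖a⁻¹ • (x - y)‖ ≤ ‖x - y‖ := by
    rw [norm_smul, Real.norm_of_nonneg (by positivity)]
    exact mul_le_of_le_one_left (norm_nonneg _) (inv_le_one_of_one_le₀ ha)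
  rw [h1]
  linarith [norm_add_le (a⁻¹ • (x - y)) ((a⁻¹ - b⁻¹) • y)]

end Radial

/-- A small perturbation of the identity which fixes the unit sphere maps the closed unit ball onto
itself. -/
theorem closedBall_subset_image_add_smul {E : Type*} [NormedAddCommGroup E] [NormedSpace ℝ E]
    [CompleteSpace E] (h : E → E) (c : NNReal)
    (hl : LipschitzOnWith c h (Metric.closedBall 0 1)) (h0 : ∀ x, ‖x‖ = 1 → h x = 0)
    (t : ℝ) (ht : 0 ≤ t) (htc : t * (2 * c) < 1) (y : E) (hy : ‖y‖ ≤ 1) :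
    ∃ x, ‖x‖ ≤ 1 ∧ x + t • h x = y := by
  -- Composing with the radial retraction makes the contraction globally defined. A fixed point
  -- outside the ball is then impossible: `h` vanishes on the sphere, so the point would be `y`.
  let F : E → E := fun x => y - t • h (radialRetraction x)
  have hF : ContractingWith (Real.toNNReal (t * (2 * c))) F := by
    refine ⟨by simpa using htc, LipschitzWith.of_dist_le_mul fun x z => ?_⟩
    rw [Real.coe_toNNReal _ (by positivity), dist_eq_norm, dist_eq_norm]
    have h1 := hl.dist_le_mul (radialRetraction x) (by simpa using norm_radialRetraction_le x)
      (radialRetraction z) (by simpa using norm_radialRetraction_le z)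
    rw [dist_eq_norm, dist_eq_norm] at h1
    have h2 := norm_radialRetraction_sub_le x z
    calc ‖F x - F z‖ = ‖t • (h (radialRetraction x) - h (radialRetraction z))‖ := by
          rw [← norm_neg]; congr 1; simp only [F, smul_sub]; abel
      _ = t * ‖h (radialRetraction x) - h (radialRetraction z)‖ := by
          rw [norm_smul, Real.norm_of_nonneg ht]
      _ ≤ t * (c * (2 * ‖x - z‖)) := by gcongr; exact h1.trans (by gcongr)
      _ = _ := by ring
  have : Nonempty E := ⟨0⟩
  let x := ContractingWith.fixedPoint F hF
  have hx : F x = x := hF.fixedPoint_isFixedPt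
  have hx1 : ‖x‖ ≤ 1 := by
    by_contra hcon
    have : h (radialRetraction x) = 0 := h0 _ (norm_radialRetraction_of_one_le (not_le.1 hcon).le)
    have h2 : x = y := by
      rw [← hx]; simp [F, this]
    rw [h2] at hcon
    exact hcon hy
  refine ⟨x, hx1, ?_⟩
  have : F x = y - t • h x := by simp only [F]; rw [radialRetraction_of_norm_le hx1]
  rw [this] at hx
  nth_rewrite 1 [← hx]
  abel

/-- There is no `C¹` retraction of the closed unit ball onto the unit sphere. -/
theorem no_contDiff_retraction {ι : Type*} [Fintype ι]
    (r : EuclideanSpace ℝ ι → EuclideanSpace ℝ ι) (hr : ∀ x, ‖x‖ ≤ 1 → ContDiffAt ℝ 1 r x)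
    (hr1 : ∀ x, ‖x‖ ≤ 1 → ‖r x‖ = 1) (hrs : ∀ x, ‖x‖ = 1 → r x = x) : False := by
  set B := Metric.closedBall (0 : EuclideanSpace ℝ ι) 1 with hB
  have memB : ∀ x, x ∈ B ↔ ‖x‖ ≤ 1 := fun x => by simp [B]
  have hBc : IsCompact B := isCompact_closedBall _ _
  let h : EuclideanSpace ℝ ι → EuclideanSpace ℝ ι := fun x => r x - x
  have hh : ∀ x ∈ B, ContDiffAt ℝ 1 h x := fun x hx => (hr x ((memB x).1 hx)).sub contDiffAt_id
  have hhd : ∀ x ∈ B, HasFDerivAt h (fderiv ℝ h x) x := fun x hx =>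
    ((hh x hx).differentiableAt (by norm_num)).hasFDerivAt
  have hcont : ContinuousOn (fderiv ℝ h) B := fun x hx =>
    ((hh x hx).fderiv_right (m := 0) (by norm_num)).continuousAt.continuousWithinAt
  obtain ⟨c, hc⟩ : ∃ c : NNReal, ∀ x ∈ B, ‖fderiv ℝ h x‖ ≤ c := by
    obtain ⟨c, hc⟩ := hBc.exists_bound_of_continuousOn hcont
    exact ⟨Real.toNNReal c, fun x hx => (hc x hx).trans (Real.le_coe_toNNReal c)⟩
  have hlip : LipschitzOnWith c h B :=
    (convex_closedBall _ _).lipschitzOnWith_of_nnnorm_fderiv_le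
      (fun x hx => (hhd x hx).differentiableAt) (fun x hx => by exact_mod_cast hc x hx)
  have hs0 : ∀ x, ‖x‖ = 1 → h x = 0 := fun x hx => by simp [h, hrs x hx]
  have hdetc : ∀ t : ℝ, ContinuousOn (fun x => (1 + t • fderiv ℝ h x).det) B := fun t =>
    ContinuousLinearMap.continuous_det.comp_continuousOn
      (continuousOn_const.add (hcont.const_smul t))
  -- For small `t` the map `x + t h(x)` is a bijection of the ball with positive Jacobian, so the
  -- integral of the Jacobian is the volume of the ball.
  have hvol : ∀ t : ℝ, 0 ≤ t → t * (2 * c) < 1 →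
      ∫ x in B, (1 + t • fderiv ℝ h x).det = (volume B).toReal := by
    intro t ht htc
    have htc' : t * c < 1 := by
      have : 0 ≤ t * c := by positivity
      linarith
    let f : EuclideanSpace ℝ ι → EuclideanSpace ℝ ι := fun x => x + t • h x
    have hf' : ∀ x ∈ B, HasFDerivWithinAt f (1 + t • fderiv ℝ h x) B x := fun x hx =>
      ((hasFDerivAt_id x).add ((hhd x hx).const_smul t)).hasFDerivWithinAt
    have hinj : InjOn f B := by
      intro x hx y hy hxy
      have h1 := hlip.dist_le_mul x hx y hy
      rw [dist_eq_norm, dist_eq_norm] at h1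
      have h2 : x - y = -(t • (h x - h y)) := by
        have : x + t • h x = y + t • h y := hxy
        rw [smul_sub, neg_sub, sub_eq_sub_iff_add_eq_add, this]; abel
      have h3 : ‖x - y‖ ≤ t * c * ‖x - y‖ := by
        calc ‖x - y‖ = t * ‖h x - h y‖ := by
              conv_lhs => rw [h2]
              rw [norm_neg, norm_smul, Real.norm_of_nonneg ht]
          _ ≤ t * (c * ‖x - y‖) := by gcongr
          _ = _ := by ring
      have h4 : ‖x - y‖ = 0 := by
        by_contra hne
        have : 0 < ‖x - y‖ := lt_of_le_of_ne (norm_nonneg _) (Ne.symm hne)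
        nlinarith
      exact sub_eq_zero.1 (norm_eq_zero.1 h4)
    have himg : f '' B = B := by
      apply Subset.antisymm
      · rintro _ ⟨x, hx, rfl⟩
        have ht1 : t ≤ 1 ∨ 1 < t := le_or_gt t 1
        rcases ht1 with ht1 | ht1
        · rw [memB] at hx ⊢
          have : f x = (1 - t) • x + t • r x := by
            simp only [f, h, smul_sub, sub_smul, one_smul]; abel
          rw [this]
          calc ‖(1 - t) • x + t • r x‖ ≤ (1 - t) * ‖x‖ + t * ‖r x‖ := by
                refine (norm_add_le _ _).trans ?_
                rw [norm_smul, norm_smul, Real.norm_of_nonneg ht,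
                  Real.norm_of_nonneg (sub_nonneg.2 ht1)]
            _ ≤ (1 - t) * 1 + t * 1 := by
                have := sub_nonneg.2 ht1
                gcongr
                exact (hr1 x hx).le
            _ = 1 := by ring
        -- Convexity fails for `t > 1`, but then `c < 1/2`. This contradicts `‖h 0‖ = 1` and `h = 0`
        -- on the sphere; in dimension zero, `‖r 0‖ = 1` is already absurd.
        · exfalso
          have hc2 : (c : ℝ) < 1 / 2 := by
            have : (0 : ℝ) ≤ c := c.2
            nlinarith
          rw [memB] at hx
          by_cases hι : Nontrivial (EuclideanSpace ℝ ι)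
          · obtain ⟨z, hz⟩ := exists_norm_eq (EuclideanSpace ℝ ι) (zero_le_one (α := ℝ))
            have e1 := hlip.dist_le_mul (z) ((memB z).2 hz.le) 0 ((memB _).2 (by simp))
            have e2 : ‖h 0‖ = 1 := by simp [h, hr1 0 (by simp)]
            rw [hs0 z hz, dist_eq_norm, dist_eq_norm, zero_sub, norm_neg, e2, sub_zero, hz] at e1
            linarith
          · rw [not_nontrivial_iff_subsingleton] at hι
            have := hr1 0 (by simp)
            rw [Subsingleton.elim (r 0) 0] at this
            simp at this
      · intro y hy
        obtain ⟨x, hx, hxy⟩ := closedBall_subset_image_add_smul h c hlip hs0 t ht htc y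
          ((memB y).1 hy)
        exact ⟨x, (memB x).2 hx, hxy⟩
    have hchange := integral_image_eq_integral_abs_det_fderiv_smul volume
      measurableSet_closedBall hf' hinj (fun _ => (1 : ℝ))
    rw [himg] at hchange
    simp only [smul_eq_mul, mul_one, integral_const, measureReal_def,
      Measure.restrict_apply_univ] at hchange
    rw [hchange]
    refine setIntegral_congr_fun measurableSet_closedBall fun x hx => ?_
    have : 0 < (1 + t • fderiv ℝ h x).det := by
      apply det_one_add_pos
      rw [norm_smul, Real.norm_of_nonneg ht]
      exact lt_of_le_of_lt (mul_le_mul_of_nonneg_left (hc x hx) ht) htc'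
    exact (abs_of_pos this).symm
  -- Since `‖r‖ = 1`, the range of the derivative of `r` is orthogonal to `r x`, hence is not the
  -- whole space. This is argued in the open ball and extended to the sphere by continuity.
  have hdet1 : ∀ x ∈ B, (1 + fderiv ℝ h x).det = 0 := by
    have hint : EqOn (fun x => (1 + (1 : ℝ) • fderiv ℝ h x).det) (fun _ => 0)
        (Metric.ball 0 1) := by
      intro x hx
      have hxB : x ∈ B := Metric.ball_subset_closedBall hx
      have hrd : HasFDerivAt r (1 + (1 : ℝ) • fderiv ℝ h x) x := by
        have := (hasFDerivAt_id x).add (hhd x hxB)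
        rw [one_smul]
        refine this.congr_of_eventuallyEq (Eventually.of_forall fun z => ?_)
        simp [h]
      by_contra hne
      have hsurj : ∃ w, (1 + (1 : ℝ) • fderiv ℝ h x) w = r x := by
        let e := LinearMap.equivOfDetNeZero
          ((1 + (1 : ℝ) • fderiv ℝ h x : EuclideanSpace ℝ ι →L[ℝ] EuclideanSpace ℝ ι) :
            EuclideanSpace ℝ ι →ₗ[ℝ] EuclideanSpace ℝ ι) hne
        obtain ⟨w, hw⟩ := e.surjective (r x)
        exact ⟨w, hw⟩
      obtain ⟨w, hw⟩ := hsurj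
      have hn : HasFDerivAt (fun z => ‖r z‖ ^ 2) (2 • (innerSL ℝ (r x)).comp
        (1 + (1 : ℝ) • fderiv ℝ h x)) x := hrd.norm_sq
      have hn2 : HasFDerivAt (fun z => ‖r z‖ ^ 2) (0 : EuclideanSpace ℝ ι →L[ℝ] ℝ) x := by
        refine (hasFDerivAt_const (1 : ℝ) x).congr_of_eventuallyEq ?_
        filter_upwards [Metric.isOpen_ball.mem_nhds hx] with z hz
        rw [hr1 z (by simpa using (Metric.ball_subset_closedBall hz)), one_pow]
      have h3 := congrArg (fun L => L w) (hn.unique hn2)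
      have h4 : inner ℝ (r x) (r x) = (0 : ℝ) := by
        simp only [_root_.smul_apply, ContinuousLinearMap.comp_apply, hw,
          innerSL_apply_apply, _root_.zero_apply, nsmul_eq_mul] at h3
        push_cast at h3
        linarith
      rw [real_inner_self_eq_norm_sq, hr1 x ((memB x).1 hxB)] at h4
      norm_num at h4
    have := hint.of_subset_closure (hdetc 1) continuousOn_const Metric.ball_subset_closedBall
      (closure_ball (0 : EuclideanSpace ℝ ι) one_ne_zero).ge
    intro x hx
    simpa using this hx
  -- The points `t0 / (i + 1)` are distinct and small enough for `hvol`, and there is one more of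
  -- them than the dimension.
  let t0 : ℝ := (1 + 2 * c)⁻¹
  let v : Fin (Fintype.card ι + 1) → ℝ := fun i => t0 / (i + 1)
  have ht0 : 0 < t0 := by positivity
  have hv : Function.Injective v := by
    intro i j hij
    have : (i : ℝ) + 1 = j + 1 := by
      have h1 : (0 : ℝ) < i + 1 := by positivity
      have h2 : (0 : ℝ) < j + 1 := by positivity
      have := hij
      simp only [v] at this
      field_simp at this
      linarith
    have : (i : ℝ) = j := by linarith
    exact Fin.ext (by exact_mod_cast this)
  have hv0 : ∀ i, 0 ≤ v i := fun i => by positivity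
  have hvc : ∀ i, v i * (2 * c) < 1 := by
    intro i
    have h1 : v i ≤ t0 := div_le_self ht0.le (by linarith [(Nat.cast_nonneg (i : ℕ) : (0:ℝ) ≤ i)])
    have h2 : t0 * (1 + 2 * c) = 1 := inv_mul_cancel₀ (by positivity)
    have : v i * (2 * c) ≤ t0 * (2 * c) := by gcongr
    linarith
  -- The integral is a polynomial in `t`, equal to the volume at all interpolation points, hence
  -- also at `t = 1`. There the integrand vanishes, while the ball has positive volume.
  have key : ∫ x in B, (1 + fderiv ℝ h x).det = (volume B).toReal := by
    have : ∀ x, (1 + fderiv ℝ h x).det = ∑ i, (Lagrange.basis Finset.univ v i).eval 1 *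
        (1 + v i • fderiv ℝ h x).det := fun x => det_one_add_eq_sum_lagrange _ v hv
    simp_rw [this]
    rw [integral_finsetSum]
    · simp_rw [integral_const_mul]
      rw [Finset.sum_congr rfl fun i _ => by rw [hvol (v i) (hv0 i) (hvc i)], ← Finset.sum_mul,
        sum_lagrange_basis_eval_one v hv, one_mul]
    · intro i _
      exact ((hdetc (v i)).integrableOn_compact hBc).const_mul _
  rw [setIntegral_congr_fun (g := fun _ => (0 : ℝ)) measurableSet_closedBall hdet1] at key
  simp only [integral_zero] at key
  have hpos : 0 < (volume B).toReal :=
    ENNReal.toReal_pos (Metric.measure_closedBall_pos _ _ one_pos).ne' hBc.measure_lt_top.ne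
  linarith

/-- A smooth self-map of the closed unit ball has a fixed point. -/
theorem exists_fixedPoint_of_contDiff {ι : Type*} [Fintype ι]
    (g : EuclideanSpace ℝ ι → EuclideanSpace ℝ ι) (hg : ContDiff ℝ 1 g)
    (hgB : ∀ x, ‖x‖ ≤ 1 → ‖g x‖ ≤ 1) : ∃ x, ‖x‖ ≤ 1 ∧ g x = x := by
  by_contra! hcon
  let v : EuclideanSpace ℝ ι → EuclideanSpace ℝ ι := fun x => x - g x
  have hv : ContDiff ℝ 1 v := contDiff_id.sub hg
  have hv0 : ∀ x, ‖x‖ ≤ 1 → 0 < ‖v x‖ ^ 2 := fun x hx => by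
    have : v x ≠ 0 := fun h => hcon x hx (sub_eq_zero.1 h).symm
    positivity
  -- This is a quarter of the discriminant of `‖x + λ v x‖² = 1` as a quadratic in `λ`. The larger
  -- root `lam` pushes `x` along the ray from `g x` to the sphere; positivity of `D` makes it
  -- smooth, and it is zero on the sphere because `⟪x, v x⟫ > 0` there.
  let D : EuclideanSpace ℝ ι → ℝ := fun x => (inner ℝ x (v x)) ^ 2 + ‖v x‖ ^ 2 * (1 - ‖x‖ ^ 2)
  have hsphere : ∀ x, ‖x‖ = 1 → 0 < inner ℝ x (v x) := by
    intro x hx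
    have h1 : ‖v x‖ ^ 2 = ‖x‖ ^ 2 - 2 * inner ℝ x (g x) + ‖g x‖ ^ 2 := norm_sub_sq_real x (g x)
    have h2 : inner ℝ x (v x) = ‖x‖ ^ 2 - inner ℝ x (g x) := by
      simp only [v, inner_sub_right, real_inner_self_eq_norm_sq]
    have h3 := hv0 x hx.le
    have h4 := hgB x hx.le
    have h5 : ‖g x‖ ^ 2 ≤ 1 := pow_le_one₀ (norm_nonneg _) h4
    rw [hx] at h1 h2
    linarith
  have hD : ∀ x, ‖x‖ ≤ 1 → 0 < D x := by
    intro x hx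
    rcases hx.lt_or_eq with h | h
    · have h1 := hv0 x hx
      have h2 : 0 < 1 - ‖x‖ ^ 2 := by
        have := pow_lt_one₀ (norm_nonneg x) h two_ne_zero
        linarith
      have := mul_pos h1 h2
      simp only [D]
      positivity
    · have := hsphere x h
      simp only [D, h]
      have := pow_pos this 2
      linarith
  let lam : EuclideanSpace ℝ ι → ℝ := fun x => (√(D x) - inner ℝ x (v x)) / ‖v x‖ ^ 2
  refine no_contDiff_retraction (fun x => x + lam x • v x) ?_ ?_ ?_
  · intro x hx
    have hDc : ContDiffAt ℝ 1 D x := by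
      have h1 : ContDiff ℝ 1 (fun x => (inner ℝ x (v x) : ℝ)) := contDiff_id.inner ℝ hv
      exact ((h1.pow 2).add ((hv.norm_sq ℝ).mul
        (contDiff_const.sub (contDiff_id.norm_sq ℝ)))).contDiffAt
    have hl : ContDiffAt ℝ 1 lam x :=
      ((hDc.sqrt (hD x hx).ne').sub (contDiff_id.inner ℝ hv).contDiffAt).div
        (hv.norm_sq ℝ).contDiffAt (hv0 x hx).ne'
    exact contDiffAt_id.add (hl.smul hv.contDiffAt)
  · intro x hx
    have h1 := hv0 x hx
    have h2 : √(D x) ^ 2 = D x := Real.sq_sqrt (hD x hx).le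
    have h3 : lam x * ‖v x‖ ^ 2 = √(D x) - inner ℝ x (v x) := div_mul_cancel₀ _ h1.ne'
    have h4 : ‖x + lam x • v x‖ ^ 2 = 1 := by
      rw [norm_add_sq_real, inner_smul_right, norm_smul, mul_pow, Real.norm_eq_abs, sq_abs]
      have h5 : ‖v x‖ ^ 2 * (‖x‖ ^ 2 + 2 * (lam x * inner ℝ x (v x)) + lam x ^ 2 * ‖v x‖ ^ 2 - 1)
          = 0 := by
        have : ‖v x‖ ^ 2 * (‖x‖ ^ 2 + 2 * (lam x * inner ℝ x (v x)) + lam x ^ 2 * ‖v x‖ ^ 2 - 1)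
          = (lam x * ‖v x‖ ^ 2 + inner ℝ x (v x)) ^ 2 - D x := by simp only [D]; ring
        rw [this, h3, sub_add_cancel, h2, sub_self]
      rcases mul_eq_zero.1 h5 with h | h
      · exact absurd h h1.ne'
      · linarith
    nlinarith [norm_nonneg (x + lam x • v x)]
  · intro x hx
    have h1 := hsphere x hx
    have : D x = (inner ℝ x (v x)) ^ 2 := by simp [D, hx]
    have : lam x = 0 := by simp only [lam, this, Real.sqrt_sq h1.le, sub_self, zero_div]
    simp [this]

/-- **Brouwer's fixed point theorem** for the closed unit ball of a Euclidean space. -/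
theorem brouwer_unitBall {ι : Type*} [Fintype ι]
    (f : EuclideanSpace ℝ ι → EuclideanSpace ℝ ι) (hf : Continuous f)
    (hfB : ∀ x, ‖x‖ ≤ 1 → ‖f x‖ ≤ 1) : ∃ x, ‖x‖ ≤ 1 ∧ f x = x := by
  by_contra! hcon
  have hcomp : IsCompact (Metric.closedBall (0 : EuclideanSpace ℝ ι) 1) := isCompact_closedBall _ _
  obtain ⟨x₀, hx₀, hmin⟩ := hcomp.exists_isMinOn ⟨0, by simp⟩
    (f := fun x => ‖f x - x‖) (by fun_prop)
  set m := ‖f x₀ - x₀‖ with hm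
  have hm0 : 0 < m := norm_pos_iff.2 (sub_ne_zero.2 (hcon x₀ (by simpa using hx₀)))
  have hδ0 : 0 < m / 4 := by positivity
  -- The approximation error and the rescaling by `1 + δ` each cost at most `δ`, so the displacement
  -- of `f` at the fixed point obtained is at most `m / 2`, below its minimum `m`.
  set δ := m / 4 with hδ
  obtain ⟨g, hg, hgf, -⟩ := hf.exists_contDiff_approx 1 (ε := fun _ => δ) continuous_const
    (fun _ => hδ0)
  have hg1 : ContDiff ℝ 1 g := by simpa using hg
  have hgn : ∀ x, ‖x‖ ≤ 1 → ‖g x‖ ≤ 1 + δ := by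
    intro x hx
    have h1 := hgf x
    rw [dist_eq_norm] at h1
    have h2 := norm_add_le (f x) (g x - f x)
    rw [add_sub_cancel] at h2
    linarith [hfB x hx]
  obtain ⟨x, hx, hgx⟩ := exists_fixedPoint_of_contDiff (fun x => (1 + δ)⁻¹ • g x)
    (hg1.const_smul _) (fun x hx => by
      rw [norm_smul, Real.norm_of_nonneg (by positivity), inv_mul_le_iff₀ (by positivity), mul_one]
      exact hgn x hx)
  have h1 : g x = (1 + δ) • x := by
    rw [← hgx, smul_smul, mul_inv_cancel₀ (by positivity), one_smul, hgx]
  have h2 : ‖g x - x‖ ≤ δ := by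
    have : g x - x = δ • x := by rw [h1, add_smul, one_smul]; abel
    rw [this, norm_smul, Real.norm_of_nonneg hδ0.le]
    exact mul_le_of_le_one_right hδ0.le hx
  have h3 := hgf x
  rw [dist_eq_norm, ← norm_neg, neg_sub] at h3
  have h4 : m ≤ ‖f x - x‖ := hmin (by simpa using hx)
  have h5 := norm_add_le (f x - g x) (g x - x)
  rw [sub_add_sub_cancel] at h5
  linarith

/-! ### Brouwer's theorem on the simplex. -/

/-- A retraction of `ℝⁿ` onto the standard simplex. -/
noncomputable def simplexRetraction {ι : Type*} [Fintype ι] (a : ι → ℝ) : ι → ℝ := fun i =>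
  -- If the positive parts sum to less than one, the deficit is shared equally; if to more, they are
  -- normalized. At most one of the two corrections is active.
  (max (a i) 0 + max 0 (1 - ∑ j, max (a j) 0) / Fintype.card ι) / max (∑ j, max (a j) 0) 1

section Simplex

variable {ι : Type*} [Fintype ι]

theorem continuous_simplexRetraction : Continuous (simplexRetraction (ι := ι)) := by
  refine continuous_pi fun i => Continuous.div (by fun_prop) (by fun_prop) fun a => ?_
  have : 1 ≤ max (∑ j, max (a j) 0) 1 := le_max_right _ _
  linarith

theorem simplexRetraction_mem [Nonempty ι] (a : ι → ℝ) :
    simplexRetraction a ∈ stdSimplex ℝ ι := by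
  have h1 : 1 ≤ max (∑ j, max (a j) 0) 1 := le_max_right _ _
  constructor
  · intro i
    unfold simplexRetraction
    positivity
  · unfold simplexRetraction
    rw [← Finset.sum_div, Finset.sum_add_distrib, Finset.sum_const, Finset.card_univ, nsmul_eq_mul,
      mul_div_cancel₀ _ (by exact_mod_cast Fintype.card_ne_zero), div_eq_one_iff_eq (by linarith)]
    rcases le_total (∑ j, max (a j) 0) 1 with h | h
    · rw [max_eq_right h, max_eq_right (by linarith)]; ring
    · rw [max_eq_left h, max_eq_left (by linarith)]; ring

theorem simplexRetraction_of_mem {a : ι → ℝ} (ha : a ∈ stdSimplex ℝ ι) :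
    simplexRetraction a = a := by
  have h1 : ∀ i, max (a i) 0 = a i := fun i => max_eq_left (ha.1 i)
  ext i
  simp [simplexRetraction, h1, ha.2]

/-- **Brouwer's fixed point theorem** for the standard simplex. -/
theorem brouwer_stdSimplex [Nonempty ι] (f : (ι → ℝ) → ι → ℝ)
    (hf : ContinuousOn f (stdSimplex ℝ ι)) (hmaps : MapsTo f (stdSimplex ℝ ι) (stdSimplex ℝ ι)) :
    ∃ a ∈ stdSimplex ℝ ι, f a = a := by
  have hnorm : ∀ a ∈ stdSimplex ℝ ι, ‖WithLp.toLp 2 a‖ ≤ 1 := by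
    intro a ha
    have h1 : ∑ i, a i ^ 2 ≤ 1 := by
      rw [← ha.2]
      refine Finset.sum_le_sum fun i _ => ?_
      have h2 : a i ≤ 1 := by
        rw [← ha.2]
        exact Finset.single_le_sum (fun j _ => ha.1 j) (Finset.mem_univ i)
      nlinarith [ha.1 i]
    rw [EuclideanSpace.norm_eq]
    simpa using h1
  have hc : Continuous fun a : ι → ℝ => f (simplexRetraction a) :=
    hf.comp_continuous continuous_simplexRetraction simplexRetraction_mem
  obtain ⟨x, -, hx⟩ := brouwer_unitBall
    (fun x : EuclideanSpace ℝ ι => WithLp.toLp 2 (f (simplexRetraction x.ofLp)))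
    ((PiLp.continuous_toLp 2 _).comp (hc.comp (PiLp.continuous_ofLp 2 _)))
    (fun x _ => hnorm _ (hmaps (simplexRetraction_mem _)))
  have h1 : f (simplexRetraction x.ofLp) = x.ofLp := congrArg WithLp.ofLp hx
  have h2 : x.ofLp ∈ stdSimplex ℝ ι := h1 ▸ hmaps (simplexRetraction_mem _)
  refine ⟨x.ofLp, h2, ?_⟩
  rwa [simplexRetraction_of_mem h2] at h1

end Simplex

/-! ### Fixed points of multivalued maps. -/

/-- **Kakutani–Fan–Glicksberg fixed point theorem**, for a multivalued map of which only the upper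
hemicontinuity is assumed: some point lies in the closed convex hull of its own image. -/
theorem exists_mem_closure_convexHull {E : Type*} [NormedAddCommGroup E] [NormedSpace ℝ E]
    [CompleteSpace E] {M : Set E} (hMc : IsClosed M) (hMconv : Convex ℝ M) (hMne : M.Nonempty)
    (Q : E → Set E) (hQne : ∀ x ∈ M, (Q x).Nonempty) (hQM : ∀ x ∈ M, Q x ⊆ M)
    (hQtb : TotallyBounded (⋃ x ∈ M, Q x))
    (huhc : ∀ x ∈ M, ∀ ε > 0, ∃ δ > 0, ∀ x' ∈ M, dist x' x < δ → Q x' ⊆ Metric.thickening ε (Q x)) :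
    ∃ x ∈ M, x ∈ closure (convexHull ℝ (Q x)) := by
  let K := closure (convexHull ℝ (⋃ x ∈ M, Q x))
  have hKc : IsCompact K := TotallyBounded.isCompact_of_isClosed
    (totallyBounded_convexHull.2 hQtb).closure isClosed_closure
  have hQK : ∀ x ∈ M, Q x ⊆ convexHull ℝ (⋃ x ∈ M, Q x) := fun x hx =>
    (subset_biUnion_of_mem hx).trans (subset_convexHull ℝ _)
  have hKM : K ⊆ M := by
    refine closure_minimal (convexHull_min ?_ hMconv) hMc
    exact iUnion₂_subset hQM
  have happrox : ∀ ε > 0, ∃ x ∈ K, x ∈ convexHull ℝ (⋃ x' ∈ M ∩ Metric.ball x ε, Q x') := by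
    intro ε hε
    obtain ⟨s, hsK, hsfin, hs⟩ := hKc.finite_cover_balls hε
    have := hsfin.fintype
    choose! y hy using hQne
    have hyK : ∀ i : s, y i ∈ convexHull ℝ (⋃ x ∈ M, Q x) := fun i =>
      hQK i (hKM (hsK i.2)) (hy i (hKM (hsK i.2)))
    obtain ⟨z₀, hz₀⟩ := hMne
    have hzK : y z₀ ∈ K := subset_closure (hQK z₀ hz₀ (hy z₀ hz₀))
    have hcover : ∀ x ∈ K, ∃ i : s, dist x i < ε := fun x hx => by
      obtain ⟨i, hi, hxi⟩ := mem_iUnion₂.1 (hs hx)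
      exact ⟨⟨i, hi⟩, hxi⟩
    have : Nonempty s := ⟨(hcover _ hzK).choose⟩
    -- These bumps, divided by their sum `S`, form a partition of unity on `K`. Brouwer is applied
    -- to the coefficients `a`, and at the fixed point `a i ≠ 0` forces the centre `i` to lie within
    -- `ε` of `c a`.
    let β : s → E → ℝ := fun i x => max 0 (ε - dist x i)
    have hβc : ∀ i, Continuous (β i) := fun i => by fun_prop
    have hβ0 : ∀ i x, 0 ≤ β i x := fun i x => le_max_left _ _
    let S : E → ℝ := fun x => ∑ i, β i x
    have hS : ∀ x ∈ K, 0 < S x := fun x hx => by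
      obtain ⟨i, hi⟩ := hcover x hx
      exact Finset.sum_pos' (fun i _ => hβ0 i x)
        ⟨i, Finset.mem_univ _, lt_max_of_lt_right (sub_pos.2 hi)⟩
    let c : (s → ℝ) → E := fun a => ∑ i, a i • y i
    have hcc : Continuous c := by fun_prop
    have hcK : ∀ a ∈ stdSimplex ℝ s, c a ∈ K := fun a ha => subset_closure
      ((convex_convexHull ℝ _).sum_mem (fun i _ => ha.1 i) ha.2 fun i _ => hyK i)
    obtain ⟨a, ha, hfix⟩ := brouwer_stdSimplex (fun a i => β i (c a) / S (c a))
      (continuousOn_pi.2 fun i => ((hβc i).comp hcc).continuousOn.div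
        (Continuous.continuousOn (by fun_prop)) fun a ha => (hS _ (hcK a ha)).ne')
      (fun a ha => ⟨fun i => div_nonneg (hβ0 _ _) (hS _ (hcK a ha)).le, by
        rw [← Finset.sum_div]; exact div_self (hS _ (hcK a ha)).ne'⟩)
    refine ⟨c a, hcK a ha, ?_⟩
    have hsum : c a = ∑ i with a i ≠ 0, a i • y i := by
      rw [Finset.sum_filter_of_ne]
      intro i _ hi h0
      exact hi (by simp [h0])
    have hsum1 : ∑ i with a i ≠ 0, a i = 1 := by
      rw [Finset.sum_filter_ne_zero]; exact ha.2
    have hmem : ∑ i with a i ≠ 0, a i • y i ∈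
        convexHull ℝ (⋃ x' ∈ M ∩ Metric.ball (c a) ε, Q x') := by
      refine (convex_convexHull ℝ _).sum_mem (fun i _ => ha.1 i) hsum1 fun i hi => ?_
      have hai : a i ≠ 0 := (Finset.mem_filter.1 hi).2
      refine subset_convexHull ℝ _ (mem_iUnion₂.2 ⟨i, ⟨hKM (hsK i.2), ?_⟩, hy i (hKM (hsK i.2))⟩)
      by_contra hcon
      apply hai
      rw [← congrFun hfix i]
      have : β i (c a) = 0 := by
        refine max_eq_left ?_
        rw [Metric.mem_ball, dist_comm] at hcon
        linarith
      simp [this]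
    rwa [← hsum] at hmem
  choose x hxK hx using fun n : ℕ => happrox (1 / ((n : ℝ) + 1)) (by positivity)
  obtain ⟨z, hzK, φ, hφ, hlim⟩ := hKc.tendsto_subseq hxK
  refine ⟨z, hKM hzK, ?_⟩
  rw [Metric.mem_closure_iff]
  intro ε hε
  obtain ⟨δ, hδ, hδQ⟩ := huhc z (hKM hzK) (ε / 2) (by positivity)
  have h1 : ∀ᶠ n in atTop, dist (x (φ n)) z < min (δ / 2) (ε / 2) :=
    (tendsto_iff_dist_tendsto_zero.1 hlim).eventually (gt_mem_nhds (by positivity))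
  have h2 : ∀ᶠ n in atTop, 1 / ((φ n : ℝ) + 1) < δ / 2 :=
    (tendsto_one_div_add_atTop_nhds_zero_nat.comp hφ.tendsto_atTop).eventually
      (gt_mem_nhds (by positivity))
  obtain ⟨n, hn1, hn2⟩ := (h1.and h2).exists
  -- A thickening of a convex set is convex, so the inclusion of the nearby images passes to their
  -- convex hull.
  have h3 : x (φ n) ∈ Metric.thickening (ε / 2) (convexHull ℝ (Q z)) := by
    refine convexHull_min ?_ ((convex_convexHull ℝ _).thickening _) (hx (φ n))
    refine iUnion₂_subset fun x' hx' => (hδQ x' hx'.1 ?_).trans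
      (Metric.thickening_subset_of_subset _ (subset_convexHull ℝ _))
    have := Metric.mem_ball.1 hx'.2
    have := lt_of_lt_of_le hn1 (min_le_left _ _)
    linarith [dist_triangle x' (x (φ n)) z]
  obtain ⟨w, hw, hwd⟩ := Metric.mem_thickening_iff.1 h3
  refine ⟨w, hw, ?_⟩
  have := lt_of_lt_of_le hn1 (min_le_right _ _)
  have := dist_triangle_left z w (x (φ n))
  linarith

/-! ### Convergence of paths and elementary properties of controls. -/

namespace SwitchingGame

variable {N : ℕ}

/-- Convergence, along a filter, of paths coded as lists: the nodes are eventually those of the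
limit path, and the switching instants converge. -/
def PathTendsto {ι : Type*} (F : Filter ι) :
    (ι → List (Node N × ℝ)) → List (Node N × ℝ) → Prop
  | u, [] => ∀ᶠ n in F, u n = []
  | u, (q, τ) :: l => ∃ (τ' : ι → ℝ) (l' : ι → List (Node N × ℝ)),
      (∀ᶠ n in F, u n = (q, τ' n) :: l' n) ∧ Tendsto τ' F (𝓝 τ) ∧ PathTendsto F l' l

/-- Along an ultrafilter, every family of paths with bounded lengths and instants converges. -/
theorem exists_pathTendsto {ι : Type*} (F : Ultrafilter ι) (a b : ℝ) (m : ℕ) :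
    ∀ u : ι → List (Node N × ℝ),
      (∀ᶠ n in F, (u n).length ≤ m ∧ ∀ x ∈ u n, x.2 ∈ Icc a b) → ∃ l, PathTendsto F u l := by
  induction m with
  | zero =>
    intro u hu
    exact ⟨[], hu.mono fun n hn => List.length_eq_zero_iff.1 (Nat.le_zero.1 hn.1)⟩
  | succ m ih =>
    intro u hu
    -- An ultrafilter decides whether the paths are eventually empty or eventually nonempty; in the
    -- second case it also fixes the first node and makes the first instant converge.
    rcases F.em (fun n => u n = []) with h | h
    · exact ⟨[], h⟩
    · have hK : IsCompact ((univ : Set (Node N)) ×ˢ Icc a b) := isCompact_univ.prod isCompact_Icc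
      let hd : ι → Node N × ℝ := fun n => (u n).headD default
      have hcons : ∀ᶠ n in F, u n = hd n :: (u n).tail := h.mono fun n hn => by
        obtain ⟨x, l, hxl⟩ := List.exists_cons_of_ne_nil hn
        simp [hd, hxl]
      have hmem : ∀ᶠ n in F, hd n ∈ (univ : Set (Node N)) ×ˢ Icc a b := by
        filter_upwards [hu, hcons] with n hn hc
        exact ⟨mem_univ _, hn.2 _ (by rw [hc]; exact List.mem_cons_self)⟩
      obtain ⟨⟨q, τ⟩, -, hx⟩ := hK.ultrafilter_le_nhds (F.map hd) (le_principal_iff.2 hmem)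
      have hx' : Tendsto hd F (𝓝 (q, τ)) := hx
      obtain ⟨l, hl⟩ := ih (fun n => (u n).tail) (by
        filter_upwards [hu, hcons] with n hn hc
        rw [hc] at hn
        refine ⟨by simpa using hn.1, fun x hx => hn.2 x (List.mem_cons_of_mem _ hx)⟩)
      have hfst : Tendsto (fun n => (hd n).1) F (𝓝 q) := (continuous_fst.tendsto _).comp hx'
      rw [nhds_discrete, tendsto_pure] at hfst
      refine ⟨(q, τ) :: l, fun n => (hd n).2, fun n => (u n).tail, ?_,
        (continuous_snd.tendsto _).comp hx', hl⟩
      filter_upwards [hcons, hfst] with n hc hq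
      rw [← hq]
      exact hc

/-- The number of targets which still have to be visited. -/
def remaining (p : Node N) : ℕ := (Finset.univ.filter fun i => p i = false).card

theorem remaining_lt_of_mem_nextNodes {p q : Node N} (h : q ∈ nextNodes p) :
    remaining q < remaining p := by
  obtain ⟨i, hi, rfl⟩ := h
  refine Finset.card_lt_card ⟨fun j hj => ?_, fun hsub => ?_⟩
  · simp only [Finset.mem_filter, Finset.mem_univ, true_and] at hj ⊢
    by_cases hij : j = i
    · rw [hij]; exact hi
    · rwa [Function.update_of_ne hij] at hj
  · have := hsub (by simpa using hi : i ∈ Finset.univ.filter fun i => p i = false)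
    simp at this

theorem nextNodes_nonempty {p : Node N} (hp : p ≠ finalNode N) : (nextNodes p).Nonempty := by
  have : ∃ i, p i = false := by
    by_contra! h
    exact hp (funext fun i => by simpa [finalNode] using h i)
  obtain ⟨i, hi⟩ := this
  exact ⟨_, i, hi, rfl⟩

theorem ne_finalNode_of_mem_nextNodes {p q : Node N} (h : q ∈ nextNodes p) : p ≠ finalNode N := by
  rintro rfl
  obtain ⟨i, hi, -⟩ := h
  simp [finalNode] at hi

variable {G : SwitchingGame N}

/-- Each switch visits one more target. This bounds the number of switches uniformly and is the
source of all compactness of paths. -/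
theorem IsControl.length_le {l : List (Node N × ℝ)} :
    ∀ {p : Node N} {t : ℝ}, G.IsControl p t l → l.length ≤ remaining p := by
  induction l with
  | nil => simp
  | cons x l ih =>
    intro p t h
    have h1 := ih h.2.2.2
    have h2 := remaining_lt_of_mem_nextNodes h.1
    simp only [List.length_cons]
    omega

theorem remaining_le (p : Node N) : remaining p ≤ N :=
  (Finset.card_filter_le _ _).trans (by simp)

theorem IsControl.mem_Icc {l : List (Node N × ℝ)} :
    ∀ {p : Node N} {t : ℝ}, G.IsControl p t l → ∀ x ∈ l, x.2 ∈ Icc t G.T := by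
  induction l with
  | nil => simp
  | cons y l ih =>
    intro p t h x hx
    rcases List.mem_cons.1 hx with rfl | hx
    · exact ⟨h.2.1.le, h.2.2.1⟩
    · have := ih h.2.2.2 x hx
      exact ⟨h.2.1.le.trans this.1, this.2⟩

theorem IsControl.le_T {l : List (Node N × ℝ)} {p : Node N} {t : ℝ} (h : G.IsControl p t l) :
    t ≤ G.T := by
  cases l with
  | nil => rcases h with h | h; exacts [h.2, h.le]
  | cons x l => exact h.2.1.le.trans h.2.2.1

theorem exists_isControl (p : Node N) {t : ℝ} (ht : t ≤ G.T) : ∃ l, G.IsControl p t l := by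
  by_cases hp : p = finalNode N
  · exact ⟨[], Or.inl ⟨hp, ht⟩⟩
  rcases ht.lt_or_eq with h | h
  · obtain ⟨q, hq⟩ := nextNodes_nonempty hp
    exact ⟨[(q, G.T)], hq, h, le_rfl, Or.inr rfl⟩
  · exact ⟨[], Or.inr h⟩

theorem Standing.exists_bound_Cfin (hG : G.Standing) :
    ∃ M, ∀ p, ∀ t ∈ Icc 0 G.T, |G.Cfin p t| ≤ M := by
  obtain ⟨K, hK⟩ := hG.Cfin_lipschitz
  choose M hM using fun p =>
    isCompact_Icc.exists_bound_of_continuousOn (hK p).continuousOn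
  refine ⟨∑ p, |M p|, fun p t ht => (hM p t ht).trans ((le_abs_self _).trans ?_)⟩
  exact Finset.single_le_sum (f := fun p => |M p|) (fun q _ => abs_nonneg _) (Finset.mem_univ p)

theorem Standing.exists_le_J (hG : G.Standing) :
    ∃ M, ∀ ρ p t l, 0 ≤ t → G.IsControl p t l → -M ≤ G.J ρ p t l := by
  obtain ⟨M, hM⟩ := hG.exists_bound_Cfin
  refine ⟨M, fun ρ p t l ht hl => ?_⟩
  induction l generalizing p t with
  | nil => exact (abs_le.1 (hM p t ⟨ht, hl.le_T⟩)).1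
  | cons x l ih =>
    have h1 := ih x.1 x.2 (ht.trans hl.2.1.le) hl.2.2.2
    have h2 := hG.C_nonneg p x.1 hl.1 t x.2 ht hl.2.1 hl.2.2.1 ρ
    change -M ≤ G.C p x.1 t x.2 ρ + G.J ρ x.1 x.2 l
    linarith

/-- The assumption concerns only small `h`, but a larger gap `d` is covered by any smaller `h`,
since `[0, τ - d] ⊆ [0, τ - h]`. -/
theorem Standing.exists_lipschitz_const (hG : G.Standing) {d : ℝ} (hd : 0 < d) :
    ∃ L, 0 ≤ L ∧ ∀ p, ∀ q ∈ nextNodes p, ∀ τ ∈ Ioc 0 G.T,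
      ∀ t₁ ∈ Icc 0 (τ - d), ∀ t₂ ∈ Icc 0 (τ - d), ∀ ρ₁ ρ₂ : MassSpace N G.T,
      |G.C p q t₁ τ ρ₁ - G.C p q t₂ τ ρ₂| ≤ L * (|t₁ - t₂| + ‖ρ₁.1 - ρ₂.1‖) := by
  obtain ⟨h, ⟨L, B, hL⟩, hh⟩ := (hG.C_lipschitz.and (Ioo_mem_nhdsGT hd)).exists
  refine ⟨max L 0, le_max_right _ _, fun p q hq τ hτ t₁ h₁ t₂ h₂ ρ₁ ρ₂ => ?_⟩
  have hmono : Icc 0 (τ - d) ⊆ Icc 0 (τ - h) := Icc_subset_Icc_right (by linarith [hh.2])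
  refine ((hL p q hq τ hτ).2 t₁ (hmono h₁) t₂ (hmono h₂) ρ₁ ρ₂).trans ?_
  gcongr
  exact le_max_left _ _

/-! ### Semicontinuity of the cost. -/

section Limits

variable {ι : Type*} {F : Filter ι} {ρ : ι → MassSpace N G.T} {ρ₀ : MassSpace N G.T}

theorem Standing.tendsto_C (hG : G.Standing)
    (hρ : Tendsto (fun n => ‖(ρ n).1 - ρ₀.1‖) F (𝓝 0)) {p q : Node N} (hq : q ∈ nextNodes p)
    {t τ : ℝ} (ht : 0 ≤ t) (htτ : t < τ) (hτ : τ ≤ G.T) :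
    Tendsto (fun n => G.C p q t τ (ρ n)) F (𝓝 (G.C p q t τ ρ₀)) := by
  obtain ⟨L, -, hL⟩ := hG.exists_lipschitz_const (sub_pos.2 htτ)
  have hmem : t ∈ Icc 0 (τ - (τ - t)) := ⟨ht, by linarith⟩
  rw [tendsto_iff_dist_tendsto_zero]
  have h0 : Tendsto (fun n => L * (|t - t| + ‖(ρ n).1 - ρ₀.1‖)) F (𝓝 0) := by
    simpa using hρ.const_mul L
  refine squeeze_zero (fun _ => dist_nonneg) (fun n => ?_) h0
  exact hL p q hq τ ⟨ht.trans_lt htτ, hτ⟩ t hmem t hmem (ρ n) ρ₀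

theorem Standing.tendsto_J (hG : G.Standing)
    (hρ : Tendsto (fun n => ‖(ρ n).1 - ρ₀.1‖) F (𝓝 0)) {l : List (Node N × ℝ)} :
    ∀ {p : Node N} {t : ℝ}, 0 ≤ t → G.IsControl p t l →
      Tendsto (fun n => G.J (ρ n) p t l) F (𝓝 (G.J ρ₀ p t l)) := by
  induction l with
  | nil => exact fun _ _ => tendsto_const_nhds
  | cons x l ih =>
    intro p t ht hl
    exact (hG.tendsto_C hρ hl.1 ht hl.2.1 hl.2.2.1).add (ih (ht.trans hl.2.1.le) hl.2.2.2)

/-- Joint lower semicontinuity of the switching cost, away from the diagonal `τ = t`. -/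
theorem Standing.eventually_C_le (hG : G.Standing) [F.NeBot]
    (hρ : Tendsto (fun n => ‖(ρ n).1 - ρ₀.1‖) F (𝓝 0)) {p q : Node N} (hq : q ∈ nextNodes p)
    {t τ : ι → ℝ} {t₀ τ₀ δ : ℝ} (ht : Tendsto t F (𝓝 t₀)) (hτ : Tendsto τ F (𝓝 τ₀)) (hδ : 0 < δ)
    (hev : ∀ᶠ n in F, 0 ≤ t n ∧ τ n ≤ G.T ∧ δ ≤ τ n - t n) {ε : ℝ} (hε : 0 < ε) :
    ∀ᶠ n in F, G.C p q t₀ τ₀ ρ₀ ≤ G.C p q (t n) (τ n) (ρ n) + ε := by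
  have ht₀ : 0 ≤ t₀ := ge_of_tendsto ht (hev.mono fun n h => h.1)
  have hτ₀ : τ₀ ≤ G.T := le_of_tendsto hτ (hev.mono fun n h => h.2.1)
  have hδ₀ : δ ≤ τ₀ - t₀ := ge_of_tendsto (hτ.sub ht) (hev.mono fun n h => h.2.2)
  -- Half of the gap is given up so that the limit instant `t₀`, and not only `t n`, eventually lies
  -- in `[0, τ n - δ / 2]`.
  obtain ⟨L, -, hL⟩ := hG.exists_lipschitz_const (half_pos hδ)
  have h0 : Tendsto (fun n => L * (|t n - t₀| + ‖(ρ n).1 - ρ₀.1‖)) F (𝓝 0) := by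
    have h1 : Tendsto (fun n => |t n - t₀|) F (𝓝 0) := by
      simpa using (ht.sub_const t₀).abs
    simpa using (h1.add hρ).const_mul L
  have hclose : ∀ᶠ n in F, t₀ < t n + δ / 2 := by
    have : Tendsto (fun n => t n + δ / 2) F (𝓝 (t₀ + δ / 2)) := ht.add_const _
    exact this.eventually (lt_mem_nhds (by linarith))
  -- At `τ₀ = T` continuity in the switching instant is not assumed, but monotonicity gives the
  -- inequality because `τ n ≤ T`.
  have hlsc : ∀ᶠ n in F, G.C p q t₀ τ₀ ρ₀ ≤ G.C p q t₀ (τ n) ρ₀ + ε / 2 := by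
    have ht₀T : t₀ ∈ Ico 0 G.T := ⟨ht₀, by linarith⟩
    rcases hτ₀.lt_or_eq with h | h
    · have hc : ContinuousAt (fun τ => G.C p q t₀ τ ρ₀) τ₀ :=
        (hG.C_continuous p q hq t₀ ht₀T ρ₀).continuousAt
          (Ioo_mem_nhds (by linarith) h)
      have := (hc.tendsto.comp hτ).add_const (ε / 2)
      exact (this.eventually (lt_mem_nhds (by linarith : G.C p q t₀ τ₀ ρ₀ < _))).mono
        fun n hn => le_of_lt hn
    · filter_upwards [hev, hclose] with n hn hc
      have := hG.C_antitone p q hq t₀ ht₀T ρ₀ (a := τ n) (b := τ₀)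
        ⟨by linarith [hn.2.2], hn.2.1⟩ ⟨by linarith, hτ₀⟩ (h ▸ hn.2.1)
      simp only at this
      linarith
  filter_upwards [hev, hclose, hlsc, h0.eventually (gt_mem_nhds (half_pos hε))] with n hn hc h1 h2
  have h3 := hL p q hq (τ n) ⟨by linarith [hn.2.2], hn.2.1⟩ (t n) ⟨hn.1, by linarith [hn.2.2]⟩ t₀
    ⟨ht₀, by linarith [hn.2.2]⟩ (ρ n) ρ₀
  have h4 := (abs_le.1 h3).1
  linarith

/-- Limits of controls of bounded cost are controls, and the cost is lower semicontinuous. -/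
theorem Standing.eventually_J_le (hG : G.Standing) [F.NeBot]
    (hρ : Tendsto (fun n => ‖(ρ n).1 - ρ₀.1‖) F (𝓝 0)) (A : ℝ) {l : List (Node N × ℝ)} :
    ∀ {p : Node N} {t : ι → ℝ} {t₀ : ℝ} {u : ι → List (Node N × ℝ)}, Tendsto t F (𝓝 t₀) →
      PathTendsto F u l → (∀ᶠ n in F, 0 ≤ t n ∧ G.IsControl p (t n) (u n) ∧
        G.J (ρ n) p (t n) (u n) ≤ A) →
      G.IsControl p t₀ l ∧
        ∀ ε > 0, ∀ᶠ n in F, G.J ρ₀ p t₀ l ≤ G.J (ρ n) p (t n) (u n) + ε := by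
  induction l with
  | nil =>
    intro p t t₀ u ht hu hev
    have ht₀ : 0 ≤ t₀ := ge_of_tendsto ht (hev.mono fun n h => h.1)
    have ht₀T : t₀ ≤ G.T := le_of_tendsto ht (hev.mono fun n h => h.2.1.le_T)
    have hnil : ∀ᶠ n in F, G.IsControl p (t n) [] := by
      filter_upwards [hev, hu] with n h hn
      rw [← hn]; exact h.2.1
    refine ⟨?_, fun ε hε => ?_⟩
    · by_cases hp : p = finalNode N
      · exact Or.inl ⟨hp, ht₀T⟩
      · refine Or.inr (tendsto_nhds_unique ht (tendsto_const_nhds.congr' ?_))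
        filter_upwards [hnil] with n hn
        rcases hn with h | h
        exacts [absurd h.1 hp, h.symm]
    · obtain ⟨K, hK⟩ := hG.Cfin_lipschitz
      have hwithin : Tendsto t F (𝓝[Icc 0 G.T] t₀) := tendsto_nhdsWithin_iff.2
        ⟨ht, hev.mono fun n h => ⟨h.1, h.2.1.le_T⟩⟩
      have hc : Tendsto (fun n => G.Cfin p (t n) + ε) F (𝓝 (G.Cfin p t₀ + ε)) :=
        ((((hK p).continuousOn t₀ ⟨ht₀, ht₀T⟩).tendsto).comp hwithin).add_const ε
      filter_upwards [hu, hc.eventually (lt_mem_nhds (by linarith : G.Cfin p t₀ < _))] with n hn h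
      rw [hn]
      exact h.le
  | cons x l ih =>
    obtain ⟨q, τ₀⟩ := x
    rintro p t t₀ u ht ⟨τ, u', hu, hτ, hu'⟩ hev
    obtain ⟨M, hM⟩ := hG.exists_le_J
    -- With total cost at most `A` and remaining cost at least `-M`, the first switch costs at most
    -- `A + M`. A blow-up threshold strictly above this forces a gap of at least `δ`, which survives
    -- in the limit.
    obtain ⟨δ, hδ, hblow⟩ := hG.C_blowup (A + M + 1)
    have hq : q ∈ nextNodes p := by
      obtain ⟨n, h, hn⟩ := (hev.and hu).exists
      rw [hn] at h
      exact h.2.1.1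
    have hev2 : ∀ᶠ n in F, (0 ≤ t n ∧ τ n ≤ G.T ∧ δ ≤ τ n - t n) ∧
        (0 ≤ τ n ∧ G.IsControl q (τ n) (u' n) ∧ G.J (ρ n) q (τ n) (u' n) ≤ A) := by
      filter_upwards [hev, hu] with n h hn
      rw [hn] at h
      obtain ⟨h0, ⟨-, htτ, hτT, hcon⟩, hJ⟩ := h
      have hτ0 : 0 ≤ τ n := h0.trans htτ.le
      have hJ' : G.C p q (t n) (τ n) (ρ n) + G.J (ρ n) q (τ n) (u' n) ≤ A := hJ
      have h1 := hM (ρ n) q (τ n) (u' n) hτ0 hcon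
      have h2 := hG.C_nonneg p q hq (t n) (τ n) h0 htτ hτT (ρ n)
      refine ⟨⟨h0, hτT, ?_⟩, hτ0, hcon, by linarith⟩
      by_contra! hlt
      have := hblow p q hq (t n) ⟨h0, htτ.trans_le hτT⟩ (τ n) ⟨htτ, hτT⟩ hlt (ρ n)
      linarith
    obtain ⟨hcon, hlim⟩ := ih hτ hu' (hev2.mono fun n h => h.2)
    have hδ₀ : δ ≤ τ₀ - t₀ := ge_of_tendsto (hτ.sub ht) (hev2.mono fun n h => h.1.2.2)
    refine ⟨⟨hq, by linarith, hcon.le_T, hcon⟩, fun ε hε => ?_⟩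
    filter_upwards [hu, hlim (ε / 2) (half_pos hε),
      hG.eventually_C_le hρ hq ht hτ hδ (hev2.mono fun n h => h.1) (half_pos hε)] with n hn h1 h2
    rw [hn]
    change G.C p q t₀ τ₀ ρ₀ + G.J ρ₀ q τ₀ l ≤
      G.C p q (t n) (τ n) (ρ n) + G.J (ρ n) q (τ n) (u' n) + ε
    linarith

end Limits

/-! ### Optimal controls, the principle of optimality and finiteness of optimal paths. -/

/-- The control `l` from `(p, t)` has the least cost. -/
def IsOptControl (G : SwitchingGame N) (ρ : MassSpace N G.T) (p : Node N) (t : ℝ)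
    (l : List (Node N × ℝ)) : Prop :=
  G.IsControl p t l ∧ ∀ l', G.IsControl p t l' → G.J ρ p t l ≤ G.J ρ p t l'

/-- The set of pairs (mass, optimal control) is closed. -/
theorem Standing.isOptControl_of_tendsto (hG : G.Standing) {ι : Type*} {F : Filter ι} [F.NeBot]
    {ρ : ι → MassSpace N G.T} {ρ₀ : MassSpace N G.T}
    (hρ : Tendsto (fun n => ‖(ρ n).1 - ρ₀.1‖) F (𝓝 0)) {p : Node N} {t : ℝ} (ht : 0 ≤ t)
    {u : ι → List (Node N × ℝ)} {l : List (Node N × ℝ)} (hu : PathTendsto F u l)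
    (hopt : ∀ᶠ n in F, G.IsOptControl (ρ n) p t (u n)) : G.IsOptControl ρ₀ p t l := by
  -- Admissibility does not depend on the mass, so a competitor for `ρ₀` also competes for each `ρ
  -- n`, and its cost converges.
  have hbound : ∀ l', G.IsControl p t l' →
      ∀ ε > 0, ∀ᶠ n in F, G.J (ρ n) p t (u n) ≤ G.J ρ₀ p t l' + ε := by
    intro l' hl' ε hε
    filter_upwards [hopt, (hG.tendsto_J hρ ht hl').eventually
      (gt_mem_nhds (by linarith : _ < G.J ρ₀ p t l' + ε))] with n h1 h2
    exact (h1.2 l' hl').trans h2.le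
  obtain ⟨n₁, hn₁⟩ := hopt.exists
  obtain ⟨hl, hlim⟩ := hG.eventually_J_le hρ (G.J ρ₀ p t (u n₁) + 1) (tendsto_const_nhds (x := t))
    hu (by
      filter_upwards [hopt, hbound _ hn₁.1 1 one_pos] with n h1 h2
      exact ⟨ht, h1.1, h2⟩)
  refine ⟨hl, fun l' hl' => le_of_forall_pos_le_add fun ε hε => ?_⟩
  obtain ⟨n, h1, h2⟩ := ((hlim (ε / 2) (half_pos hε)).and
    (hbound l' hl' (ε / 2) (half_pos hε))).exists
  linarith

theorem Standing.bddBelow_J (hG : G.Standing) (ρ : MassSpace N G.T) (p : Node N) {t : ℝ}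
    (ht : 0 ≤ t) : BddBelow (G.J ρ p t '' {l | G.IsControl p t l}) := by
  obtain ⟨M, hM⟩ := hG.exists_le_J
  refine ⟨-M, ?_⟩
  rintro _ ⟨l, hl, rfl⟩
  exact hM ρ p t l ht hl

/-- Direct method: a minimizing sequence has a limit path along an ultrafilter, and its costs are
bounded by the infimum plus one, so lower semicontinuity applies. -/
theorem Standing.exists_isOptControl (hG : G.Standing) (ρ : MassSpace N G.T) (p : Node N) {t : ℝ}
    (ht : t ∈ Icc 0 G.T) : ∃ l, G.IsOptControl ρ p t l := by
  have hne : (G.J ρ p t '' {l | G.IsControl p t l}).Nonempty := by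
    obtain ⟨l, hl⟩ := exists_isControl p ht.2
    exact ⟨_, l, hl, rfl⟩
  have happrox : ∀ n : ℕ, ∃ l, G.IsControl p t l ∧ G.J ρ p t l < G.V ρ p t + 1 / ((n : ℝ) + 1) := by
    intro n
    obtain ⟨_, ⟨l, hl, rfl⟩, h⟩ := exists_lt_of_csInf_lt hne
      (lt_add_of_pos_right (G.V ρ p t) (by positivity : (0 : ℝ) < 1 / ((n : ℝ) + 1)))
    exact ⟨l, hl, h⟩
  choose u hu hJ using happrox
  let F : Ultrafilter ℕ := hyperfilter ℕ
  obtain ⟨l, hl⟩ := exists_pathTendsto F t G.T N u (Eventually.of_forall fun n =>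
    ⟨(hu n).length_le.trans (remaining_le p), (hu n).mem_Icc⟩)
  have hρ : Tendsto (fun _ : ℕ => ‖ρ.1 - ρ.1‖) F (𝓝 0) := by simp
  obtain ⟨hcon, hlim⟩ := hG.eventually_J_le hρ (G.V ρ p t + 1) (tendsto_const_nhds (x := t)) hl
    (Eventually.of_forall fun n => ⟨ht.1, hu n, (hJ n).le.trans (by
      gcongr
      rw [div_le_one (by positivity)]
      linarith [(Nat.cast_nonneg n : (0 : ℝ) ≤ n)])⟩)
  refine ⟨l, hcon, fun l' hl' => ?_⟩
  have hV : G.V ρ p t ≤ G.J ρ p t l' := csInf_le (hG.bddBelow_J ρ p ht.1) ⟨l', hl', rfl⟩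
  refine le_trans (le_of_forall_pos_le_add fun ε hε => ?_) hV
  have h0 : ∀ᶠ n : ℕ in F, 1 / ((n : ℝ) + 1) < ε / 2 :=
    (tendsto_one_div_add_atTop_nhds_zero_nat.mono_left Nat.hyperfilter_le_atTop).eventually
      (gt_mem_nhds (half_pos hε))
  obtain ⟨n, h1, h2⟩ := ((hlim (ε / 2) (half_pos hε)).and h0).exists
  linarith [hJ n]

theorem IsOptControl.V_eq {ρ : MassSpace N G.T} {p : Node N} {t : ℝ} {l : List (Node N × ℝ)}
    (h : G.IsOptControl ρ p t l) : G.V ρ p t = G.J ρ p t l :=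
  IsLeast.csInf_eq ⟨⟨l, h.1, rfl⟩, by rintro _ ⟨l', hl', rfl⟩; exact h.2 l' hl'⟩

theorem Standing.V_le_J (hG : G.Standing) (ρ : MassSpace N G.T) {p : Node N} {t : ℝ} (ht : 0 ≤ t)
    {l : List (Node N × ℝ)} (hl : G.IsControl p t l) : G.V ρ p t ≤ G.J ρ p t l :=
  csInf_le (hG.bddBelow_J ρ p ht) ⟨l, hl, rfl⟩

/-- The principle of optimality. -/
theorem Standing.isOptControl_cons_iff (hG : G.Standing) {ρ : MassSpace N G.T} {p q : Node N}
    {t τ : ℝ} (ht : 0 ≤ t) {l : List (Node N × ℝ)} :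
    G.IsOptControl ρ p t ((q, τ) :: l) ↔ (q, τ) ∈ G.P ρ p t ∧ G.IsOptControl ρ q τ l := by
  constructor
  · rintro ⟨⟨hq, htτ, hτ, hl⟩, hmin⟩
    have hopt : G.IsOptControl ρ q τ l := by
      refine ⟨hl, fun l' hl' => ?_⟩
      have : G.C p q t τ ρ + G.J ρ q τ l ≤ G.C p q t τ ρ + G.J ρ q τ l' :=
        hmin ((q, τ) :: l') ⟨hq, htτ, hτ, hl'⟩
      linarith
    refine ⟨⟨⟨hq, htτ, hτ⟩, fun y hy => ?_⟩, hopt⟩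
    obtain ⟨q', τ'⟩ := y
    obtain ⟨l', hl'⟩ := hG.exists_isOptControl ρ q' (t := τ') ⟨ht.trans hy.2.1.le, hy.2.2⟩
    have h : G.C p q t τ ρ + G.J ρ q τ l ≤ G.C p q' t τ' ρ + G.J ρ q' τ' l' :=
      hmin ((q', τ') :: l') ⟨hy.1, hy.2.1, hy.2.2, hl'.1⟩
    change G.V ρ q τ + G.C p q t τ ρ ≤ G.V ρ q' τ' + G.C p q' t τ' ρ
    rw [hopt.V_eq, hl'.V_eq]
    linarith
  · rintro ⟨⟨⟨hq, htτ, hτ⟩, hmin⟩, hopt⟩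
    refine ⟨⟨hq, htτ, hτ, hopt.1⟩, fun l' hl' => ?_⟩
    cases l' with
    | nil =>
      rcases hl' with h | h
      · exact absurd h.1 (ne_finalNode_of_mem_nextNodes hq)
      · exact absurd (htτ.trans_le hτ) (by rw [h]; exact lt_irrefl _)
    | cons y l' =>
      obtain ⟨q', τ'⟩ := y
      obtain ⟨hq', htτ', hτ', hl'⟩ := hl'
      have h1 : G.V ρ q τ + G.C p q t τ ρ ≤ G.V ρ q' τ' + G.C p q' t τ' ρ :=
        hmin (a := (q', τ')) ⟨hq', htτ', hτ'⟩
      have h2 := hG.V_le_J ρ (ht.trans htτ'.le) hl'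
      rw [hopt.V_eq] at h1
      change G.C p q t τ ρ + G.J ρ q τ l ≤ G.C p q' t τ' ρ + G.J ρ q' τ' l'
      linarith

/-- The principle of optimality is iterated along the list. It starts from terminal pairs, where no
switch is possible and the empty control has no competitor. -/
theorem Standing.isOptControl_iff_isOptPath (hG : G.Standing) {ρ : MassSpace N G.T}
    {l : List (Node N × ℝ)} : ∀ {p : Node N} {t : ℝ}, t ∈ Icc 0 G.T →
      (G.IsOptControl ρ p t l ↔ G.IsOptPath ρ p t l) := by
  induction l with
  | nil =>
    intro p t ht
    constructor
    · rintro ⟨h | h, -⟩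
      exacts [Or.inl h.1, Or.inr h]
    · intro h
      have hc : G.IsControl p t [] := by
        rcases h with h | h
        exacts [Or.inl ⟨h, ht.2⟩, Or.inr h]
      refine ⟨hc, fun l' hl' => ?_⟩
      cases l' with
      | nil => exact le_rfl
      | cons y l' =>
        rcases h with h | h
        · exact absurd h (ne_finalNode_of_mem_nextNodes hl'.1)
        · exact absurd (hl'.2.1.trans_le hl'.2.2.1) (by rw [h]; exact lt_irrefl _)
  | cons x l ih =>
    intro p t ht
    obtain ⟨q, τ⟩ := x
    rw [hG.isOptControl_cons_iff ht.1]
    refine and_congr_right fun h => ih ⟨ht.1.trans h.1.2.1.le, h.1.2.2⟩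

theorem Standing.P_nonempty (hG : G.Standing) (ρ : MassSpace N G.T) {p : Node N}
    (hp : p ≠ finalNode N) {t : ℝ} (ht : t ∈ Ico 0 G.T) : (G.P ρ p t).Nonempty := by
  obtain ⟨l, hl⟩ := hG.exists_isOptControl ρ p ⟨ht.1, ht.2.le⟩
  cases l with
  | nil =>
    rcases hl.1 with h | h
    exacts [absurd h.1 hp, absurd h ht.2.ne]
  | cons x l => exact ⟨x, ((hG.isOptControl_cons_iff ht.1).1 hl).1⟩

/-- Following the switch by an optimal control gives a minimizer among all controls, a fortiori
among those that first go to `q`. This is the link between `P` and the single-valuedness of `φ`. -/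
theorem Standing.optGenerates_of_mem_P (hG : G.Standing) {ρ : MassSpace N G.T} {p q : Node N}
    {t τ : ℝ} (ht : 0 ≤ t) (h : (q, τ) ∈ G.P ρ p t) : G.OptGenerates ρ p q t τ := by
  obtain ⟨l, hl⟩ := hG.exists_isOptControl ρ q (t := τ) ⟨ht.trans h.1.2.1.le, h.1.2.2⟩
  have := (hG.isOptControl_cons_iff ht).2 ⟨h, hl⟩
  exact ⟨l, this.1, fun τ₁ l₁ h₁ => this.2 _ h₁⟩

theorem Reached.mem_Icc (hG : G.Standing) {ρ : MassSpace N G.T} {p : Node N} {t : ℝ}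
    (h : G.Reached ρ p t) : t ∈ Icc 0 G.T := by
  induction h with
  | start p _ => exact ⟨le_rfl, hG.T_pos.le⟩
  | step p q t τ _ hP ih => exact ⟨ih.1.trans hP.1.2.1.le, hP.1.2.2⟩

theorem PhiSingleValued.finite_P (hφ : G.PhiSingleValued) (hG : G.Standing) {ρ : MassSpace N G.T}
    {p : Node N} {t : ℝ} (h : G.Reached ρ p t) : (G.P ρ p t).Finite := by
  refine Finite.of_injOn (f := Prod.fst) (t := univ) (mapsTo_univ _ _) ?_ finite_univ
  rintro ⟨q, τ₁⟩ h₁ ⟨q', τ₂⟩ h₂ hqq'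
  obtain rfl : q = q' := hqq'
  rw [hφ ρ p t h q h₁.1.1 τ₁ τ₂ (hG.optGenerates_of_mem_P (h.mem_Icc hG).1 h₁)
    (hG.optGenerates_of_mem_P (h.mem_Icc hG).1 h₂)]

/-- At each reached pair the next node determines the switching instant, so the instants can be
recovered one after the other from the nodes. -/
theorem PhiSingleValued.isOptPath_unique (hφ : G.PhiSingleValued) (hG : G.Standing)
    {ρ : MassSpace N G.T} {l : List (Node N × ℝ)} : ∀ {p : Node N} {t : ℝ}, G.Reached ρ p t →
      G.IsOptPath ρ p t l → ∀ l', G.IsOptPath ρ p t l' → l.map Prod.fst = l'.map Prod.fst →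
        l = l' := by
  induction l with
  | nil => intro p t _ _ l' _ h; exact (List.map_eq_nil_iff.1 h.symm).symm
  | cons x l ih =>
    rintro p t hr ⟨hx, hl⟩ l' hl' hmap
    cases l' with
    | nil => simp at hmap
    | cons y l' =>
      obtain ⟨q, τ⟩ := x
      obtain ⟨q', τ'⟩ := y
      obtain ⟨hy, hl'⟩ := hl'
      simp only [List.map_cons, List.cons.injEq] at hmap
      obtain ⟨rfl, hmap⟩ := hmap
      have : τ = τ' := hφ ρ p t hr q hx.1.1 τ τ'
        (hG.optGenerates_of_mem_P (hr.mem_Icc hG).1 hx)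
        (hG.optGenerates_of_mem_P (hr.mem_Icc hG).1 hy)
      subst this
      rw [ih (hr.step _ _ _ _ hx) hl l' hl' hmap]

/-- There are finitely many optimal paths from a pair reached by the agents. -/
theorem PhiSingleValued.finite_isOptPath (hφ : G.PhiSingleValued) (hG : G.Standing)
    {ρ : MassSpace N G.T} {p : Node N} {t : ℝ} (h : G.Reached ρ p t) :
    {l | G.IsOptPath ρ p t l}.Finite := by
  refine Finite.of_injOn (f := List.map Prod.fst) (t := {l : List (Node N) | l.length ≤ N}) ?_
    (fun l hl l' hl' => hφ.isOptPath_unique hG h hl l' hl') (List.finite_length_le _ _)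
  intro l hl
  have := ((hG.isOptControl_iff_isOptPath (h.mem_Icc hG)).2 hl).1.length_le
  simpa using this.trans (remaining_le p)

end SwitchingGame

/-! ### Mass evolutions as elements of `L²`. -/

namespace SwitchingGame

instance (T : ℝ) : IsFiniteMeasure (timeMeasure T) := by
  unfold timeMeasure; infer_instance

/-- The indicator of `[a, +∞[`, as an element of `L²([0, T])`. -/
noncomputable def stepLp (T a : ℝ) : Lp ℝ 2 (timeMeasure T) :=
  indicatorConstLp 2 (measurableSet_Ici (a := a)) (measure_ne_top _ _) 1

/-- The half-lines from `x` and from `y` differ by a set of measure at most `|y - x|`. -/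
theorem continuous_stepLp (T : ℝ) : Continuous (stepLp T) := by
  refine continuous_indicatorConstLp_set (by norm_num) fun x => ?_
  have h0 : Tendsto (fun y : ℝ => ENNReal.ofReal |y - x|) (𝓝 x) (𝓝 0) := by
    have : Continuous fun y : ℝ => ENNReal.ofReal |y - x| :=
      ENNReal.continuous_ofReal.comp (by fun_prop)
    simpa using this.tendsto x
  refine tendsto_of_tendsto_of_tendsto_of_le_of_le tendsto_const_nhds h0 (fun _ => zero_le)
    fun y => ?_
  rw [← Real.volume_interval]
  refine (Measure.restrict_apply_le _ _).trans (measure_mono fun s hs => ?_)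
  rw [mem_uIcc]
  rcases hs with h | h
  · exact Or.inr ⟨h.1, (not_le.1 h.2).le⟩
  · exact Or.inl ⟨h.1, (not_le.1 h.2).le⟩

theorem stepLp_ae (T a : ℝ) :
    ∀ᵐ s ∂(timeMeasure T), stepLp T a s = if a ≤ s then 1 else 0 := by
  filter_upwards [indicatorConstLp_coeFn (p := 2) (hs := measurableSet_Ici (a := a))
    (hμs := measure_ne_top (timeMeasure T) _) (c := (1 : ℝ))] with s hs
  rw [stepLp, hs]
  simp [indicator_apply]

variable {N : ℕ}

/-- The presence of an agent on the nodes of a path, as an element of a product of `L²` spaces. -/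
noncomputable def presenceLp (T : ℝ) :
    Node N → ℝ → List (Node N × ℝ) → Node N → Lp ℝ 2 (timeMeasure T)
  | p, t, [], k => if p = k then stepLp T t else 0
  | p, t, (q, τ) :: l, k => (if p = k then stepLp T t - stepLp T τ else 0) + presenceLp T q τ l k

theorem tendsto_presenceLp (T : ℝ) {ι : Type*} {F : Filter ι} {l : List (Node N × ℝ)} :
    ∀ {p : Node N} {t : ι → ℝ} {t₀ : ℝ} {u : ι → List (Node N × ℝ)}, Tendsto t F (𝓝 t₀) →
      PathTendsto F u l →
      Tendsto (fun n => presenceLp T p (t n) (u n)) F (𝓝 (presenceLp T p t₀ l)) := by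
  induction l with
  | nil =>
    intro p t t₀ u ht hu
    have h : Tendsto (fun n => presenceLp T p (t n) []) F (𝓝 (presenceLp T p t₀ [])) := by
      refine tendsto_pi_nhds.2 fun k => ?_
      simp only [presenceLp]
      split_ifs
      exacts [((continuous_stepLp T).tendsto t₀).comp ht, tendsto_const_nhds]
    exact h.congr' (hu.mono fun n hn => by simp only [hn])
  | cons x l ih =>
    obtain ⟨q, τ₀⟩ := x
    rintro p t t₀ u ht ⟨τ, u', hu, hτ, hu'⟩
    have h : Tendsto (fun n => presenceLp T p (t n) ((q, τ n) :: u' n)) F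
        (𝓝 (presenceLp T p t₀ ((q, τ₀) :: l))) := by
      refine tendsto_pi_nhds.2 fun k => ?_
      simp only [presenceLp]
      refine Tendsto.add ?_ (tendsto_pi_nhds.1 (ih hτ hu') k)
      split_ifs
      exacts [(((continuous_stepLp T).tendsto t₀).comp ht).sub
        (((continuous_stepLp T).tendsto τ₀).comp hτ), tendsto_const_nhds]
    exact h.congr' (hu.mono fun n hn => by simp only [hn])

variable {G : SwitchingGame N}

/-- A difference of two half-line indicators is the indicator of `[t, τ[` only if `t ≤ τ`, which is
where admissibility of the path is needed. -/
theorem presenceLp_ae {l : List (Node N × ℝ)} : ∀ {p : Node N} {t : ℝ}, G.IsControl p t l →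
    ∀ k, ∀ᵐ s ∂(timeMeasure G.T), presenceLp G.T p t l k s = presence p t l k s := by
  induction l with
  | nil =>
    intro p t _ k
    filter_upwards [stepLp_ae G.T t, Lp.coeFn_zero ℝ 2 (timeMeasure G.T)] with s hs h0
    by_cases hp : p = k
    · simp [presenceLp, presence, hp, hs]
    · simp only [presenceLp, presence, hp, if_false, false_and, h0, Pi.zero_apply]
  | cons x l ih =>
    obtain ⟨q, τ⟩ := x
    intro p t hl k
    filter_upwards [stepLp_ae G.T t, stepLp_ae G.T τ, ih hl.2.2.2 k,
      Lp.coeFn_add (if p = k then stepLp G.T t - stepLp G.T τ else 0) (presenceLp G.T q τ l k),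
      Lp.coeFn_sub (stepLp G.T t) (stepLp G.T τ), Lp.coeFn_zero ℝ 2 (timeMeasure G.T)]
      with s hs₁ hs₂ ih' hadd hsub h0
    have htτ := hl.2.1
    simp only [presenceLp, presence]
    rw [hadd, Pi.add_apply, ih']
    congr 1
    by_cases hp : p = k
    · simp only [hp, if_true, hsub, Pi.sub_apply, hs₁, hs₂, true_and]
      by_cases h1 : t ≤ s <;> by_cases h2 : τ ≤ s
      · simp [h1, h2, not_lt.2 h2]
      · simp [h1, h2, not_le.1 h2]
      · exact absurd (htτ.le.trans h2) h1
      · simp [h1, h2]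
    · simp only [hp, if_false, false_and, h0, Pi.zero_apply]

theorem presence_nonneg {l : List (Node N × ℝ)} :
    ∀ (p : Node N) (t : ℝ) (k : Node N) (s : ℝ), 0 ≤ presence p t l k s := by
  induction l with
  | nil => intro p t k s; simp only [presence]; split_ifs <;> norm_num
  | cons x l ih =>
    intro p t k s
    have := ih x.1 x.2 k s
    simp only [presence]
    split_ifs <;> linarith

/-- The stays on the nodes occupy consecutive disjoint intervals. Recording that nothing happens
before `t`, rather than the bound `1` alone, lets the induction close. -/
theorem IsControl.presence_le {l : List (Node N × ℝ)} :
    ∀ {p : Node N} {t : ℝ}, G.IsControl p t l → ∀ k s,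
      presence p t l k s ≤ if t ≤ s then 1 else 0 := by
  induction l with
  | nil => intro p t _ k s; simp only [presence]; split_ifs <;> simp_all
  | cons x l ih =>
    obtain ⟨q, τ⟩ := x
    intro p t hl k s
    have h := ih hl.2.2.2 k s
    have htτ : t < τ := hl.2.1
    simp only [presence]
    by_cases h1 : t ≤ s <;> by_cases h2 : τ ≤ s
    · simpa [h1, h2, not_lt.2 h2] using h
    · simp only [h2, if_false] at h
      simp only [h1, true_and, if_true]
      split_ifs <;> linarith
    · exact absurd (htτ.le.trans h2) h1
    · simpa [h1, h2] using h

/-- Componentwise this is the order interval between the constants `0` and `1` in the ordered space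
`L²`. -/
theorem isClosed_massSpace (N : ℕ) (T : ℝ) : IsClosed (MassSpace N T) := by
  have : MassSpace N T = ⋂ p, (fun ρ => ρ p) ⁻¹'
      Icc (0 : Lp ℝ 2 (timeMeasure T)) (indicatorConstLp 2 MeasurableSet.univ
        (measure_ne_top _ _) 1) := by
    ext ρ
    simp only [MassSpace, mem_ofPred_eq, mem_iInter, mem_preimage]
    refine forall_congr' fun p => ?_
    have h1 := indicatorConstLp_coeFn (p := 2) (hs := MeasurableSet.univ)
      (hμs := measure_ne_top (timeMeasure T) univ) (c := (1 : ℝ))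
    rw [mem_Icc, ← Lp.coeFn_nonneg, ← Lp.coeFn_le]
    constructor
    · intro h
      constructor
      · filter_upwards [h] with s hs using hs.1
      · filter_upwards [h, h1] with s hs h1
        rw [h1]
        simpa using hs.2
    · rintro ⟨h, h'⟩
      filter_upwards [h, h', h1] with s hs hs' h1
      rw [h1] at hs'
      exact ⟨hs, by simpa using hs'⟩
  rw [this]
  exact isClosed_iInter fun p => isClosed_Icc.preimage (continuous_apply p)

theorem convex_massSpace (N : ℕ) (T : ℝ) : Convex ℝ (MassSpace N T) := by
  intro ρ hρ σ hσ a b ha hb hab p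
  filter_upwards [hρ p, hσ p, Lp.coeFn_add (a • ρ p) (b • σ p), Lp.coeFn_smul a (ρ p),
    Lp.coeFn_smul b (σ p)] with s h1 h2 h3 h4 h5
  have : (a • ρ + b • σ) p = a • ρ p + b • σ p := rfl
  rw [this, h3, Pi.add_apply, h4, h5]
  exact (convex_Icc (0 : ℝ) 1) h1 h2 ha hb hab

theorem massSpace_nonempty (N : ℕ) (T : ℝ) : (MassSpace N T).Nonempty := by
  refine ⟨0, fun p => ?_⟩
  filter_upwards [Lp.coeFn_zero ℝ 2 (timeMeasure T)] with s hs
  have : (0 : Node N → Lp ℝ 2 (timeMeasure T)) p = 0 := rfl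
  rw [this, hs]
  simp

/-- The mass evolution when all the agents which start from `j` follow the path `l j`. -/
noncomputable def pathMass (G : SwitchingGame N) (l : Node N → List (Node N × ℝ)) :
    Node N → Lp ℝ 2 (timeMeasure G.T) :=
  ∑ j, G.init j • presenceLp G.T j 0 (l j)

theorem tendsto_pathMass {ι : Type*} {F : Filter ι} {u : ι → Node N → List (Node N × ℝ)}
    {l : Node N → List (Node N × ℝ)} (h : ∀ j, PathTendsto F (fun n => u n j) (l j)) :
    Tendsto (fun n => G.pathMass (u n)) F (𝓝 (G.pathMass l)) :=
  tendsto_finsetSum _ fun j _ => (tendsto_presenceLp G.T tendsto_const_nhds (h j)).const_smul _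

theorem coeFn_finsetSum_Lp {α κ : Type*} [MeasurableSpace α] {μ : Measure α} (A : Finset κ)
    (f : κ → Lp ℝ 2 μ) : ∀ᵐ s ∂μ, (∑ i ∈ A, f i : Lp ℝ 2 μ) s = ∑ i ∈ A, f i s := by
  classical
  induction A using Finset.induction_on with
  | empty =>
    filter_upwards [Lp.coeFn_zero ℝ 2 μ] with s hs
    simpa using hs
  | insert i A hi ih =>
    rw [Finset.sum_insert hi]
    filter_upwards [ih, Lp.coeFn_add (f i) (∑ i ∈ A, f i)] with s h1 h2
    rw [h2, Pi.add_apply, h1, Finset.sum_insert hi]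

theorem pathMass_ae {l : Node N → List (Node N × ℝ)} (hl : ∀ j, G.IsControl j 0 (l j))
    (k : Node N) : ∀ᵐ s ∂(timeMeasure G.T),
      G.pathMass l k s = ∑ j, G.init j * presence j 0 (l j) k s := by
  have h1 : G.pathMass l k = ∑ j, G.init j • presenceLp G.T j 0 (l j) k := by
    simp [pathMass, Finset.sum_apply]
  have h2 : ∀ᵐ s ∂(timeMeasure G.T), ∀ j, (G.init j • presenceLp G.T j 0 (l j) k :
      Lp ℝ 2 (timeMeasure G.T)) s = G.init j * presence j 0 (l j) k s := by
    rw [ae_all_iff]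
    intro j
    filter_upwards [presenceLp_ae (hl j) k, Lp.coeFn_smul (G.init j)
      (presenceLp G.T j 0 (l j) k)] with s h h'
    rw [h', Pi.smul_apply, h, smul_eq_mul]
  filter_upwards [h2, coeFn_finsetSum_Lp Finset.univ
    (fun j => G.init j • presenceLp G.T j 0 (l j) k)] with s hs h3
  rw [h1, h3]
  exact Finset.sum_congr rfl fun j _ => hs j

theorem Standing.pathMass_mem (hG : G.Standing) {l : Node N → List (Node N × ℝ)}
    (hl : ∀ j, G.IsControl j 0 (l j)) : G.pathMass l ∈ MassSpace N G.T := by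
  intro k
  filter_upwards [pathMass_ae hl k] with s hs
  rw [hs]
  refine ⟨Finset.sum_nonneg fun j _ => mul_nonneg (hG.init_nonneg j) (presence_nonneg _ _ _ _), ?_⟩
  refine le_trans (Finset.sum_le_sum fun j _ => ?_) hG.init_sum_le
  refine mul_le_of_le_one_right (hG.init_nonneg j) (((hl j).presence_le k s).trans ?_)
  split_ifs <;> norm_num

/-! ### Pure evolutions and a fixed point of their convex hull. -/

/-- The mass evolutions where all the agents with the same initial node choose the same optimal
path. -/
def purePsi (G : SwitchingGame N) (x : Node N → Lp ℝ 2 (timeMeasure G.T)) :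
    Set (Node N → Lp ℝ 2 (timeMeasure G.T)) :=
  {y | ∃ hx : x ∈ MassSpace N G.T, ∃ l, (∀ j, G.IsOptPath ⟨x, hx⟩ j 0 (l j)) ∧ y = G.pathMass l}

theorem Standing.zero_mem (hG : G.Standing) : (0 : ℝ) ∈ Icc 0 G.T := ⟨le_rfl, hG.T_pos.le⟩

theorem IsOptPath.isControl (hG : G.Standing) {ρ : MassSpace N G.T} {j : Node N}
    {l : List (Node N × ℝ)} (h : G.IsOptPath ρ j 0 l) : G.IsControl j 0 l :=
  ((hG.isOptControl_iff_isOptPath hG.zero_mem).2 h).1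

theorem Standing.purePsi_nonempty (hG : G.Standing) {x : Node N → Lp ℝ 2 (timeMeasure G.T)}
    (hx : x ∈ MassSpace N G.T) : (G.purePsi x).Nonempty := by
  choose l hl using fun j => hG.exists_isOptControl ⟨x, hx⟩ j hG.zero_mem
  exact ⟨_, hx, l, fun j => (hG.isOptControl_iff_isOptPath hG.zero_mem).1 (hl j), rfl⟩

theorem Standing.purePsi_subset (hG : G.Standing) (x : Node N → Lp ℝ 2 (timeMeasure G.T)) :
    G.purePsi x ⊆ MassSpace N G.T := by
  rintro _ ⟨hx, l, hl, rfl⟩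
  exact hG.pathMass_mem fun j => (hl j).isControl hG

theorem PathTendsto.length_le_and_mem_Icc {ι : Type*} {F : Filter ι} [F.NeBot] {a b : ℝ}
    {l : List (Node N × ℝ)} : ∀ {n : ℕ} {u : ι → List (Node N × ℝ)}, PathTendsto F u l →
      (∀ᶠ y in F, (u y).length ≤ n ∧ ∀ x ∈ u y, x.2 ∈ Icc a b) →
      l.length ≤ n ∧ ∀ x ∈ l, x.2 ∈ Icc a b := by
  induction l with
  | nil => simp
  | cons x l ih =>
    obtain ⟨q, τ⟩ := x
    rintro n u ⟨τ', u', hu, hτ, hu'⟩ hev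
    have hev' : ∀ᶠ y in F, 1 ≤ n ∧ τ' y ∈ Icc a b ∧ (u' y).length ≤ n - 1 ∧
        ∀ x ∈ u' y, x.2 ∈ Icc a b := by
      filter_upwards [hu, hev] with y h1 h2
      rw [h1] at h2
      have h3 := h2.1
      simp only [List.length_cons] at h3
      exact ⟨by omega, h2.2 _ List.mem_cons_self, by omega,
        fun x hx => h2.2 x (List.mem_cons_of_mem _ hx)⟩
    obtain ⟨h1, h2⟩ := ih hu' (hev'.mono fun y h => h.2.2)
    obtain ⟨y, hy⟩ := hev'.exists
    refine ⟨by simp only [List.length_cons]; omega, fun x hx => ?_⟩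
    rcases List.mem_cons.1 hx with rfl | hx
    · exact isClosed_Icc.mem_of_tendsto hτ (hev'.mono fun y h => h.2.1)
    · exact h2 x hx

/-- No topology is put on the paths: an ultrafilter of evolutions is lifted to paths by choice, and
the limit of the lifted paths gives the limit evolution. -/
theorem isCompact_pathMass (G : SwitchingGame N) :
    IsCompact (G.pathMass '' {l | ∀ j, (l j).length ≤ N ∧ ∀ x ∈ l j, x.2 ∈ Icc 0 G.T}) := by
  rw [isCompact_iff_ultrafilter_le_nhds]
  intro F hF
  rw [le_principal_iff] at hF
  choose! u hu huy using fun y (hy : y ∈ G.pathMass '' {l | ∀ j, (l j).length ≤ N ∧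
    ∀ x ∈ l j, x.2 ∈ Icc 0 G.T}) => hy
  choose l hl using fun j => exists_pathTendsto F 0 G.T N (fun y => u y j)
    (by filter_upwards [hF] with y hy using hu y hy j)
  have hlim : Tendsto (fun y => y) F (𝓝 (G.pathMass l)) :=
    (tendsto_pathMass hl).congr' (by filter_upwards [hF] with y hy using huy y hy)
  exact ⟨_, ⟨l, fun j => (hl j).length_le_and_mem_Icc
    (by filter_upwards [hF] with y hy using hu y hy j), rfl⟩, hlim⟩

theorem Standing.totallyBounded_purePsi (hG : G.Standing) :
    TotallyBounded (⋃ x ∈ MassSpace N G.T, G.purePsi x) := by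
  refine (isCompact_pathMass G).totallyBounded.subset (iUnion₂_subset fun x _ => ?_)
  rintro _ ⟨hx, l, hl, rfl⟩
  exact ⟨l, fun j => ⟨((hl j).isControl hG).length_le.trans (remaining_le j),
    ((hl j).isControl hG).mem_Icc⟩, rfl⟩

theorem Standing.exists_tendsto_purePsi (hG : G.Standing) {ι : Type*} {F : Ultrafilter ι}
    {ρ : ι → MassSpace N G.T} {ρ₀ : MassSpace N G.T}
    (hρ : Tendsto (fun n => ‖(ρ n).1 - ρ₀.1‖) F (𝓝 0))
    {y : ι → Node N → Lp ℝ 2 (timeMeasure G.T)} (hy : ∀ n, y n ∈ G.purePsi (ρ n).1) :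
    ∃ z ∈ G.purePsi ρ₀.1, Tendsto y F (𝓝 z) := by
  choose hρM l hl hyl using hy
  choose m hm using fun j => exists_pathTendsto F 0 G.T N (fun n => l n j)
    (Eventually.of_forall fun n => ⟨((hl n j).isControl hG).length_le.trans (remaining_le j),
      ((hl n j).isControl hG).mem_Icc⟩)
  refine ⟨G.pathMass m, ⟨ρ₀.2, m, fun j => ?_, rfl⟩, ?_⟩
  · exact (hG.isOptControl_iff_isOptPath hG.zero_mem).1
      (hG.isOptControl_of_tendsto hρ le_rfl (hm j)
        (Eventually.of_forall fun n => (hG.isOptControl_iff_isOptPath hG.zero_mem).2 (hl n j)))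
  · rw [show y = fun n => G.pathMass (l n) from funext hyl]
    exact tendsto_pathMass hm

/-- The pure evolutions depend on the mass in an upper hemicontinuous way. -/
theorem Standing.purePsi_uhc (hG : G.Standing) {x : Node N → Lp ℝ 2 (timeMeasure G.T)}
    (hx : x ∈ MassSpace N G.T) {ε : ℝ} (hε : 0 < ε) :
    ∃ δ > 0, ∀ x' ∈ MassSpace N G.T, dist x' x < δ →
      G.purePsi x' ⊆ Metric.thickening ε (G.purePsi x) := by
  by_contra hcon
  have hseq : ∀ n : ℕ, ∃ x' ∈ MassSpace N G.T, dist x' x < 1 / ((n : ℝ) + 1) ∧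
      ∃ y ∈ G.purePsi x', y ∉ Metric.thickening ε (G.purePsi x) := by
    intro n
    by_contra hn
    refine hcon ⟨1 / ((n : ℝ) + 1), by positivity, fun x' hx' hd y hy => ?_⟩
    by_contra hyn
    exact hn ⟨x', hx', hd, y, hy, hyn⟩
  choose x' hx' hdist y hy hyn using hseq
  have hρ : Tendsto (fun n => ‖x' n - x‖) (hyperfilter ℕ : Filter ℕ) (𝓝 0) := by
    refine squeeze_zero (fun _ => norm_nonneg _) (fun n => ?_)
      (tendsto_one_div_add_atTop_nhds_zero_nat.mono_left Nat.hyperfilter_le_atTop)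
    rw [← dist_eq_norm]
    exact (hdist n).le
  obtain ⟨z, hz, hlim⟩ := hG.exists_tendsto_purePsi (F := hyperfilter ℕ)
    (ρ := fun n => ⟨x' n, hx' n⟩) (ρ₀ := ⟨x, hx⟩) hρ hy
  obtain ⟨n, hn⟩ := (hlim.eventually (Metric.isOpen_thickening.mem_nhds
    (Metric.self_subset_thickening hε _ hz))).exists
  exact hyn n hn

theorem PhiSingleValued.finite_purePsi (hφ : G.PhiSingleValued) (hG : G.Standing)
    (x : Node N → Lp ℝ 2 (timeMeasure G.T)) : (G.purePsi x).Finite := by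
  by_cases hx : x ∈ MassSpace N G.T
  -- Paths from a node without initial mass need not be finitely many, since the single-valuedness
  -- covers reached pairs only. They carry zero mass and are replaced by the empty list.
  · let S : Node N → Set (List (Node N × ℝ)) := fun j =>
      {l | (0 < G.init j → G.IsOptPath ⟨x, hx⟩ j 0 l) ∧ (¬ 0 < G.init j → l = [])}
    have hS : (univ.pi S).Finite := by
      refine Finite.pi fun j => ?_
      by_cases hj : 0 < G.init j
      · exact (hφ.finite_isOptPath hG (Reached.start j hj)).subset fun l hl => hl.1 hj
      · exact (finite_singleton []).subset fun l hl => hl.2 hj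
    refine (hS.image G.pathMass).subset ?_
    rintro _ ⟨_, l, hl, rfl⟩
    classical
    refine ⟨fun j => if 0 < G.init j then l j else [], fun j _ => ?_, ?_⟩
    · by_cases hj : 0 < G.init j
      · simpa [S, hj] using hl j
      · simp [S, hj]
    · refine Finset.sum_congr rfl fun j _ => ?_
      by_cases hj : 0 < G.init j
      · simp [hj]
      · have : G.init j = 0 := le_antisymm (not_lt.1 hj) (hG.init_nonneg j)
        simp [this]
  · refine finite_empty.subset ?_
    rintro _ ⟨h, -⟩
    exact absurd h hx

/-- Some mass is a convex combination of the pure evolutions that are optimal for it. -/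
theorem PhiSingleValued.exists_mem_convexHull (hφ : G.PhiSingleValued) (hG : G.Standing) :
    ∃ ρ : MassSpace N G.T, ρ.1 ∈ convexHull ℝ (G.purePsi ρ.1) := by
  obtain ⟨x, hx, hmem⟩ := exists_mem_closure_convexHull (isClosed_massSpace N G.T)
    (convex_massSpace N G.T) (massSpace_nonempty N G.T) G.purePsi
    (fun x hx => hG.purePsi_nonempty hx) (fun x _ => hG.purePsi_subset x)
    hG.totallyBounded_purePsi (fun x hx ε hε => hG.purePsi_uhc hx hε)
  have hcl : IsClosed (convexHull ℝ (G.purePsi x)) :=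
    ((hφ.finite_purePsi hG x).isCompact_convexHull ℝ).isClosed
  rw [hcl.closure_eq] at hmem
  exact ⟨⟨x, hx⟩, hmem⟩

end SwitchingGame

/-! ### From mixtures of paths to splitting coefficients. -/

namespace SwitchingGame

variable {N : ℕ} {G : SwitchingGame N} {ρ : MassSpace N G.T}

theorem isOptPath_setOf_terminal {p : Node N} {t : ℝ} (h : p = finalNode N ∨ t = G.T) :
    {l | G.IsOptPath ρ p t l} = {[]} := by
  ext l
  cases l with
  | nil => simpa [IsOptPath] using h
  | cons x l =>
    refine iff_of_false (fun hl => ?_) (by simp)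
    have hx := hl.1.1
    rcases h with h | h
    · exact ne_finalNode_of_mem_nextNodes hx.1 h
    · exact absurd (hx.2.1.trans_le hx.2.2) (by rw [h]; exact lt_irrefl _)

/-- Sums over the optimal paths split according to the first switch. -/
theorem PhiSingleValued.finsum_isOptPath (hφ : G.PhiSingleValued) (hG : G.Standing) {p : Node N}
    {t : ℝ} (hr : G.Reached ρ p t) (hp : p ≠ finalNode N) (ht : t ≠ G.T)
    (f : List (Node N × ℝ) → ℝ) :
    ∑ᶠ l ∈ {l | G.IsOptPath ρ p t l}, f l =
      ∑ x ∈ (hφ.finite_P hG hr).toFinset,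
        ∑ᶠ l ∈ {l | G.IsOptPath ρ x.1 x.2 l}, f (x :: l) := by
  have hset : {l | G.IsOptPath ρ p t l} =
      ⋃ x ∈ G.P ρ p t, List.cons x '' {l | G.IsOptPath ρ x.1 x.2 l} := by
    ext l
    simp only [mem_iUnion₂]
    constructor
    · intro h
      cases l with
      | nil =>
        rcases h with h | h
        exacts [absurd h hp, absurd h ht]
      | cons x l => exact ⟨x, h.1, l, h.2, rfl⟩
    · rintro ⟨x, hx, l, hl, rfl⟩
      exact ⟨hx, hl⟩
  rw [hset, finsum_mem_biUnion, finsum_mem_eq_finite_toFinset_sum _ (hφ.finite_P hG hr)]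
  · refine Finset.sum_congr rfl fun x _ => finsum_mem_image ?_
    intro l _ l' _ h
    exact (List.cons.inj h).2
  · intro x _ y _ hxy
    refine Set.disjoint_left.2 ?_
    rintro _ ⟨l, _, rfl⟩ ⟨l', _, h⟩
    exact hxy (List.cons.inj h).1.symm
  · exact hφ.finite_P hG hr
  · exact fun x hx => (hφ.finite_isOptPath hG (hr.step _ _ _ _ hx)).image _

section Splitting

variable {lam : Node N → ℝ → (Node N × ℝ) →₀ ℝ}

theorem IsSplitting.sum_eq (hlam : G.IsSplitting ρ lam) (hφ : G.PhiSingleValued)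
    (hG : G.Standing) {p : Node N} {t : ℝ} (hr : G.Reached ρ p t) (hp : p ≠ finalNode N)
    (ht : t ≠ G.T) : ∑ x ∈ (hφ.finite_P hG hr).toFinset, lam p t x = 1 := by
  have htI : t ∈ Ico 0 G.T := ⟨(hr.mem_Icc hG).1, (hr.mem_Icc hG).2.lt_of_ne ht⟩
  rw [← (hlam p hp t htI).2.2, Finsupp.sum_of_support_subset _ _ _ (fun _ _ => rfl)]
  intro x hx
  exact (hφ.finite_P hG hr).mem_toFinset.2
    ((hlam p hp t htI).2.1 x (Finsupp.mem_support_iff.1 hx))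

/-- Total probability: conditioning on the first switch leaves the coefficients at the current pair,
which sum to one, times the same sum from a node with fewer remaining targets. -/
theorem IsSplitting.finsum_weight (hlam : G.IsSplitting ρ lam) (hφ : G.PhiSingleValued)
    (hG : G.Standing) (p : Node N) : ∀ {t : ℝ}, G.Reached ρ p t →
      ∑ᶠ l ∈ {l | G.IsOptPath ρ p t l}, weight lam p t l = 1 := by
  induction hn : remaining p using Nat.strong_induction_on generalizing p with
  | _ n ih =>
    intro t hr
    by_cases hterm : p = finalNode N ∨ t = G.T
    · rw [isOptPath_setOf_terminal hterm, finsum_mem_singleton]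
      rfl
    · rw [not_or] at hterm
      rw [hφ.finsum_isOptPath hG hr hterm.1 hterm.2, ← hlam.sum_eq hφ hG hr hterm.1 hterm.2]
      refine Finset.sum_congr rfl fun x hx => ?_
      have hx : x ∈ G.P ρ p t := (hφ.finite_P hG hr).mem_toFinset.1 hx
      have hrx : G.Reached ρ x.1 x.2 := hr.step _ _ _ _ hx
      have h1 := ih _ (hn ▸ remaining_lt_of_mem_nextNodes hx.1.1) x.1 rfl hrx
      change ∑ᶠ l ∈ {l | G.IsOptPath ρ x.1 x.2 l}, lam p t x * weight lam x.1 x.2 l = _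
      rw [← mul_finsum_mem, h1, mul_one]

/-- The expected presence on `k` at time `s` of an agent which starts from `v` and follows the
optimal paths with the probabilities given by `lam`. -/
noncomputable def meanPresence (ρ : MassSpace N G.T) (lam : Node N → ℝ → (Node N × ℝ) →₀ ℝ)
    (k : Node N) (s : ℝ) (v : Node N × ℝ) : ℝ :=
  ∑ᶠ l ∈ {l | G.IsOptPath ρ v.1 v.2 l}, weight lam v.1 v.2 l * presence v.1 v.2 l k s

/-- The gain in expected presence, when an agent on `e.1` chooses the switch `e.2`. -/
noncomputable def presenceGain (ρ : MassSpace N G.T) (lam : Node N → ℝ → (Node N × ℝ) →₀ ℝ)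
    (k : Node N) (s : ℝ) (e : (Node N × ℝ) × (Node N × ℝ)) : ℝ :=
  (if e.1.1 = k ∧ e.1.2 ≤ s ∧ s < e.2.2 then 1 else 0) + meanPresence ρ lam k s e.2 -
    meanPresence ρ lam k s e.1

theorem meanPresence_terminal {v : Node N × ℝ} (h : v.1 = finalNode N ∨ v.2 = G.T) (k : Node N)
    (s : ℝ) : meanPresence ρ lam k s v = presence v.1 v.2 [] k s := by
  rw [meanPresence, isOptPath_setOf_terminal h, finsum_mem_singleton]
  simp [weight]

/-- The expected presence does not change, on average, when an agent switches. -/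
theorem IsSplitting.sum_presenceGain (hlam : G.IsSplitting ρ lam) (hφ : G.PhiSingleValued)
    (hG : G.Standing) {v : Node N × ℝ} (hr : G.Reached ρ v.1 v.2) (hp : v.1 ≠ finalNode N)
    (ht : v.2 ≠ G.T) (k : Node N) (s : ℝ) :
    ∑ x ∈ (hφ.finite_P hG hr).toFinset, lam v.1 v.2 x * presenceGain ρ lam k s (v, x) = 0 := by
  have hrec : meanPresence ρ lam k s v = ∑ x ∈ (hφ.finite_P hG hr).toFinset, lam v.1 v.2 x *
      ((if v.1 = k ∧ v.2 ≤ s ∧ s < x.2 then 1 else 0) + meanPresence ρ lam k s x) := by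
    rw [meanPresence, hφ.finsum_isOptPath hG hr hp ht]
    refine Finset.sum_congr rfl fun x hx => ?_
    have hx : x ∈ G.P ρ v.1 v.2 := (hφ.finite_P hG hr).mem_toFinset.1 hx
    have hrx : G.Reached ρ x.1 x.2 := hr.step _ _ _ _ hx
    have hfin := hφ.finite_isOptPath hG hrx
    set g : ℝ := if v.1 = k ∧ v.2 ≤ s ∧ s < x.2 then 1 else 0 with hg
    calc ∑ᶠ l ∈ {l | G.IsOptPath ρ x.1 x.2 l},
          weight lam v.1 v.2 (x :: l) * presence v.1 v.2 (x :: l) k s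
        = ∑ᶠ l ∈ {l | G.IsOptPath ρ x.1 x.2 l}, lam v.1 v.2 x *
          (g * weight lam x.1 x.2 l + weight lam x.1 x.2 l * presence x.1 x.2 l k s) := by
          refine finsum_mem_congr rfl fun l _ => ?_
          change lam v.1 v.2 x * weight lam x.1 x.2 l * (g + presence x.1 x.2 l k s) = _
          ring
      _ = _ := by
          rw [← mul_finsum_mem, finsum_mem_add_distrib hfin, ← mul_finsum_mem,
            hlam.finsum_weight hφ hG x.1 hrx, mul_one, meanPresence]
  have hsum := hlam.sum_eq hφ hG hr hp ht
  simp only [presenceGain, mul_sub]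
  rw [Finset.sum_sub_distrib, ← hrec, ← Finset.sum_mul, hsum, one_mul, sub_self]

end Splitting

/-- The successive switches along a path: each of them is a pair made of the decision pair and of
the pair (next node, switching instant). -/
def switches : Node N → ℝ → List (Node N × ℝ) → List ((Node N × ℝ) × (Node N × ℝ))
  | _, _, [] => []
  | p, t, x :: l => ((p, t), x) :: switches x.1 x.2 l

theorem IsOptPath.reached_of_mem_switches {l : List (Node N × ℝ)} : ∀ {p : Node N} {t : ℝ},
    G.IsOptPath ρ p t l → G.Reached ρ p t → ∀ e ∈ switches p t l,
      G.Reached ρ e.1.1 e.1.2 ∧ e.2 ∈ G.P ρ e.1.1 e.1.2 := by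
  induction l with
  | nil => intro p t _ _ e he; simp [switches] at he
  | cons x l ih =>
    intro p t hl hr e he
    rcases List.mem_cons.1 he with rfl | he
    · exact ⟨hr, hl.1⟩
    · exact ih hl.2 (hr.step _ _ _ _ hl.1) e he

/-- The expected presences telescope, and at the terminal pair the expected presence is the actual
one. -/
theorem IsOptPath.sum_presenceGain {lam : Node N → ℝ → (Node N × ℝ) →₀ ℝ} (k : Node N) (s : ℝ)
    {l : List (Node N × ℝ)} : ∀ {p : Node N} {t : ℝ}, G.IsOptPath ρ p t l →
      ((switches p t l).map (presenceGain ρ lam k s)).sum =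
        presence p t l k s - meanPresence ρ lam k s (p, t) := by
  induction l with
  | nil =>
    intro p t hl
    rw [meanPresence_terminal (v := (p, t)) hl]
    simp [switches]
  | cons x l ih =>
    intro p t hl
    simp only [switches, List.map_cons, List.sum_cons, ih hl.2, presenceGain, presence]
    ring

theorem list_sum_single_apply {α : Type*} (L : List α) (e : α) :
    0 ≤ (L.map fun a => Finsupp.single a (1 : ℝ)).sum e ∧
      ((L.map fun a => Finsupp.single a (1 : ℝ)).sum e ≠ 0 → e ∈ L) := by
  classical
  induction L with
  | nil => simp
  | cons a L ih =>
    simp only [List.map_cons, List.sum_cons, Finsupp.add_apply, Finsupp.single_apply,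
      List.mem_cons]
    split_ifs with h
    · exact ⟨by linarith [ih.1], fun _ => Or.inl h.symm⟩
    · rw [zero_add]
      exact ⟨ih.1, fun h' => Or.inr (ih.2 h')⟩

section Flow

variable {κ : Type*} [Fintype κ]

/-- The flow of the agents through the switches, when the agents are divided into groups `a` of mass
`c a`, which follow the path `l a` from the node `j a`. -/
noncomputable def flow (c : κ → ℝ) (j : κ → Node N) (l : κ → List (Node N × ℝ)) :
    (Node N × ℝ) × (Node N × ℝ) →₀ ℝ :=
  ∑ a, c a • ((switches (j a) 0 (l a)).map fun e => Finsupp.single e (1 : ℝ)).sum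

variable {c : κ → ℝ} {j : κ → Node N} {l : κ → List (Node N × ℝ)}

theorem flow_nonneg (hc : ∀ a, 0 ≤ c a) (e : (Node N × ℝ) × (Node N × ℝ)) : 0 ≤ flow c j l e := by
  simp only [flow, Finsupp.finsetSum_apply, Finsupp.smul_apply, smul_eq_mul]
  exact Finset.sum_nonneg fun a _ => mul_nonneg (hc a) (list_sum_single_apply _ e).1

theorem exists_mem_switches_of_flow_ne_zero {e : (Node N × ℝ) × (Node N × ℝ)}
    (he : flow c j l e ≠ 0) : ∃ a, c a ≠ 0 ∧ e ∈ switches (j a) 0 (l a) := by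
  simp only [flow, Finsupp.finsetSum_apply, Finsupp.smul_apply, smul_eq_mul] at he
  obtain ⟨a, -, ha⟩ := Finset.exists_ne_zero_of_sum_ne_zero he
  exact ⟨a, left_ne_zero_of_mul ha, (list_sum_single_apply _ e).2 (right_ne_zero_of_mul ha)⟩

theorem sum_flow_mul (f : (Node N × ℝ) × (Node N × ℝ) → ℝ) :
    (flow c j l).sum (fun e m => m * f e) =
      ∑ a, c a * ((switches (j a) 0 (l a)).map f).sum := by
  have h : (flow c j l).sum (fun e m => m * f e) = Finsupp.linearCombination ℝ f (flow c j l) := by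
    simp [Finsupp.linearCombination_apply]
  rw [h, flow, map_sum]
  refine Finset.sum_congr rfl fun a _ => ?_
  rw [map_smul, map_list_sum, List.map_map, smul_eq_mul]
  congr 3
  funext e
  simp [Finsupp.linearCombination_single]

open Classical in
/-- The convex coefficients which are generated by a flow. At the nodes without agents, all of them
would choose the same optimal switch. -/
noncomputable def flowSplitting (ρ : MassSpace N G.T) (E : (Node N × ℝ) × (Node N × ℝ) →₀ ℝ)
    (p : Node N) (t : ℝ) : (Node N × ℝ) →₀ ℝ :=
  if E.curry (p, t) = 0 then
    if h : (G.P ρ p t).Nonempty then Finsupp.single h.some 1 else 0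
  else ((E.curry (p, t)).sum fun _ a => a)⁻¹ • E.curry (p, t)

theorem sum_curry_pos {E : (Node N × ℝ) × (Node N × ℝ) →₀ ℝ} (hE : ∀ e, 0 ≤ E e) {v : Node N × ℝ}
    (hv : E.curry v ≠ 0) : 0 < (E.curry v).sum fun _ a => a := by
  obtain ⟨x, hx⟩ := Finsupp.support_nonempty_iff.2 hv
  have hnn : ∀ y, 0 ≤ E.curry v y := fun y => by simpa [Finsupp.curry_apply] using hE (v, y)
  exact Finset.sum_pos' (fun y _ => hnn y)
    ⟨x, hx, (hnn x).lt_of_ne (Finsupp.mem_support_iff.1 hx).symm⟩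

theorem isSplitting_flowSplitting (hG : G.Standing) {E : (Node N × ℝ) × (Node N × ℝ) →₀ ℝ}
    (hE : ∀ e, 0 ≤ E e) (hEP : ∀ e, E e ≠ 0 → e.2 ∈ G.P ρ e.1.1 e.1.2) :
    G.IsSplitting ρ (flowSplitting ρ E) := by
  classical
  intro p hp t ht
  have hne := hG.P_nonempty ρ hp ht
  by_cases h0 : E.curry (p, t) = 0
  · have hl : flowSplitting ρ E p t = Finsupp.single hne.some 1 := by
      rw [flowSplitting, if_pos h0, dif_pos hne]
    rw [hl]
    refine ⟨fun x => ?_, fun x hx => ?_, by simp⟩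
    · rw [Finsupp.single_apply]; split_ifs <;> norm_num
    · rw [Finsupp.single_apply] at hx
      split_ifs at hx with h
      · rw [← h]; exact hne.some_mem
      · exact absurd rfl hx
  · have hl : flowSplitting ρ E p t =
        ((E.curry (p, t)).sum fun _ a => a)⁻¹ • E.curry (p, t) := by
      rw [flowSplitting, if_neg h0]
    have hm := sum_curry_pos hE h0
    rw [hl]
    refine ⟨fun x => ?_, fun x hx => ?_, ?_⟩
    · rw [Finsupp.smul_apply, Finsupp.curry_apply, smul_eq_mul]
      exact mul_nonneg (inv_nonneg.2 hm.le) (hE _)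
    · rw [Finsupp.smul_apply, Finsupp.curry_apply, smul_eq_mul] at hx
      exact hEP ((p, t), x) (right_ne_zero_of_mul hx)
    · rw [Finsupp.sum_smul_index (fun _ => rfl), ← Finsupp.mul_sum]
      exact inv_mul_cancel₀ hm.ne'

/-- A flow along optimal paths generates the same evolution as its convex coefficients. -/
theorem PhiSingleValued.sum_presence_eq (hφ : G.PhiSingleValued) (hG : G.Standing)
    (hc : ∀ a, 0 ≤ c a) (hinit : ∀ a, c a ≠ 0 → 0 < G.init (j a))
    (hl : ∀ a, G.IsOptPath ρ (j a) 0 (l a)) (k : Node N) (s : ℝ) :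
    ∑ a, c a * presence (j a) 0 (l a) k s =
      ∑ a, c a * meanPresence ρ (flowSplitting ρ (flow c j l)) k s (j a, 0) := by
  set E := flow c j l with hEdef
  set lam := flowSplitting ρ E with hlamdef
  have hE : ∀ e, 0 ≤ E e := flow_nonneg hc
  have hEr : ∀ e, E e ≠ 0 → G.Reached ρ e.1.1 e.1.2 ∧ e.2 ∈ G.P ρ e.1.1 e.1.2 := by
    intro e he
    obtain ⟨a, ha, hea⟩ := exists_mem_switches_of_flow_ne_zero he
    exact (hl a).reached_of_mem_switches (Reached.start _ (hinit a ha)) e hea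
  have hlam : G.IsSplitting ρ lam := isSplitting_flowSplitting hG hE fun e he => (hEr e he).2
  -- The flow is grouped by decision pair. Within a group it is proportional to the coefficients
  -- `lam`, for which the average gain is zero.
  have hzero : E.sum (fun e m => m * presenceGain ρ lam k s e) = 0 := by
    rw [← Finsupp.sum_curry_index E fun v x m => m * presenceGain ρ lam k s (v, x)]
    refine Finset.sum_eq_zero fun v hv => ?_
    have hv0 : E.curry v ≠ 0 := Finsupp.mem_support_iff.1 hv
    obtain ⟨x, hx⟩ := Finsupp.support_nonempty_iff.2 hv0
    have hx' : E (v, x) ≠ 0 := by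
      simpa [Finsupp.curry_apply] using Finsupp.mem_support_iff.1 hx
    obtain ⟨hr, hP⟩ := hEr _ hx'
    have hp : v.1 ≠ finalNode N := ne_finalNode_of_mem_nextNodes hP.1.1
    have ht : v.2 ≠ G.T := (hP.1.2.1.trans_le hP.1.2.2).ne
    have hm := sum_curry_pos hE hv0
    have h1 := hlam.sum_presenceGain hφ hG hr hp ht k s
    have h2 : ∀ x, lam v.1 v.2 x = ((E.curry v).sum fun _ a => a)⁻¹ * E.curry v x := by
      intro x
      rw [hlamdef, flowSplitting, if_neg hv0, Finsupp.smul_apply, smul_eq_mul]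
    simp_rw [h2, mul_assoc] at h1
    rw [← Finset.mul_sum] at h1
    have h3 := (mul_eq_zero.1 h1).resolve_left (inv_ne_zero hm.ne')
    refine (Finsupp.sum_of_support_subset _ ?_ _ fun _ _ => zero_mul _).trans h3
    intro y hy
    refine (hφ.finite_P hG hr).mem_toFinset.2 (hEr (v, y) ?_).2
    simpa [Finsupp.curry_apply] using Finsupp.mem_support_iff.1 hy
  rw [hEdef, sum_flow_mul] at hzero
  rw [← sub_eq_zero, ← Finset.sum_sub_distrib]
  refine Eq.trans ?_ hzero
  refine Finset.sum_congr rfl fun a _ => ?_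
  rw [(hl a).sum_presenceGain k s, mul_sub]

end Flow

/-- The convex combinations of the pure evolutions are mass evolutions. -/
theorem PhiSingleValued.mem_psi_of_mem_convexHull (hφ : G.PhiSingleValued) (hG : G.Standing)
    {σ : MassSpace N G.T} (h : σ.1 ∈ convexHull ℝ (G.purePsi ρ.1)) : σ ∈ G.psi ρ := by
  obtain ⟨ι, _, w, z, hw, hw1, hz, hσ⟩ := mem_convexHull_iff_exists_fintype.1 h
  choose hρ l hl hzl using hz
  have hl : ∀ i j, G.IsOptPath ρ j 0 (l i j) := hl
  -- One group of agents for each pure evolution in the combination and each initial node. The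
  -- groups starting from `j` have total mass `G.init j` because the weights `w` sum to one.
  let c : ι × Node N → ℝ := fun a => w a.1 * G.init a.2
  have hc : ∀ a, 0 ≤ c a := fun a => mul_nonneg (hw a.1) (hG.init_nonneg a.2)
  have hinit : ∀ a, c a ≠ 0 → 0 < G.init a.2 := fun a ha =>
    (hG.init_nonneg a.2).lt_of_ne (right_ne_zero_of_mul ha).symm
  let E := flow c Prod.snd (fun a => l a.1 a.2)
  have hsplit : G.IsSplitting ρ (flowSplitting ρ E) := by
    refine isSplitting_flowSplitting hG (flow_nonneg hc) fun e he => ?_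
    obtain ⟨a, ha, hea⟩ := exists_mem_switches_of_flow_ne_zero he
    exact ((hl a.1 a.2).reached_of_mem_switches (Reached.start _ (hinit a ha)) e hea).2
  refine ⟨_, hsplit, fun k => ?_⟩
  have h1 : ∀ᵐ s ∂(timeMeasure G.T), ∀ i, (w i • z i k : Lp ℝ 2 (timeMeasure G.T)) s =
      w i * ∑ j, G.init j * presence j 0 (l i j) k s := by
    rw [ae_all_iff]
    intro i
    filter_upwards [Lp.coeFn_smul (w i) (z i k),
      pathMass_ae (fun j => (hl i j).isControl hG) k] with s h2 h3
    rw [h2, Pi.smul_apply, smul_eq_mul, hzl i, h3]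
  have h2 : σ.1 k = ∑ i, w i • z i k := by
    rw [← hσ]; simp [Finset.sum_apply]
  filter_upwards [h1, coeFn_finsetSum_Lp Finset.univ (fun i => w i • z i k)] with s hs hsum
  have hkey := hφ.sum_presence_eq hG hc hinit (fun a => hl a.1 a.2) k s
  rw [h2, hsum]
  calc ∑ i, (w i • z i k : Lp ℝ 2 (timeMeasure G.T)) s
      = ∑ a : ι × Node N, c a * presence a.2 0 (l a.1 a.2) k s := by
        rw [Fintype.sum_prod_type]
        refine Finset.sum_congr rfl fun i _ => ?_
        rw [hs i, Finset.mul_sum]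
        exact Finset.sum_congr rfl fun j _ => (mul_assoc _ _ _).symm
    _ = ∑ a : ι × Node N, c a * meanPresence ρ (flowSplitting ρ E) k s (a.2, 0) := hkey
    _ = G.evolution ρ (flowSplitting ρ E) k s := by
        rw [Fintype.sum_prod_type_right, evolution]
        refine Finset.sum_congr rfl fun j _ => ?_
        simp only [c]
        rw [← Finset.sum_mul, ← Finset.sum_mul, hw1, one_mul]
        rfl

end SwitchingGame

theorem theorem6p1 (N : ℕ) (G : SwitchingGame N) (hG : G.Standing) (hφ : G.PhiSingleValued) :
    ∃ ρ : MassSpace N G.T, ρ ∈ G.psi ρ := by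
  obtain ⟨ρ, hρ⟩ := hφ.exists_mem_convexHull hG
  exact ⟨ρ, hφ.mem_psi_of_mem_convexHull hG hρ⟩
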